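/- Double categories, double functors and natural transformations are taken in the usual sense: a (pseudo) double category $\mathbb D$ has objects, arrows $f\colon x\to y$ (forming a category), proarrows $m\colon x\nrightarrow y$, and cells; internal composition of cells (written $\cdot$) is strict and external composition $\odot$ (written in diagrammatic order, with identities $\mathrm{id}_x$, $\mathrm{id}_f$) is associative and unital up to coherent invertible globular cells; double functors are pseudo. Its underlying bicategory $\mathbf D$ has the objects, proarrows and globular cells of $\mathbb D$, and a double functor $F$ induces a pseudofunctor, again denoted $F$, between underlying bicategories. A double adjunction $(\eta,\varepsilon)\colon F\dashv G\colon \mathbb D\rightleftarrows\mathbb E$ between pseudo double functors consists of natural transformations $\eta\colon 1_{\mathbb D}\Rightarrow G\circ F$ and $\varepsilon\colon F\circ G\Rightarrow 1_{\mathbb E}$ (with component arrows at objects and component cells at proarrows) satisfying the triangle identities strictly. A companion of an arrow $f\colon x\to y$ is a proarrow $f_!\colon x\nrightarrow y$ with cells $u\colon \mathrm{id}_x\to f_!$ (source arrow $1_x$, target arrow $f$) and $c\colon f_!\to \mathrm{id}_y$ (source arrow $f$, target arrow $1_y$) such that $u\odot c=1_{f_!}$ modulo unitors and $u\cdot c=\mathrm{id}_f$.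 If $f\colon x\to w$ and $g\colon y\to z$ have companions, a cell $\alpha$ from $m\colon x\nrightarrow y$ to $n\colon w\nrightarrow z$ with source $f$ and target $g$ gives the globular cell $\alpha_!\colon m\odot g_!\to f_!\odot n$, namely $u_f\odot\alpha\odot c_g$ modulo unitors; $\alpha$ is a commuter if $\alpha_!$ is invertible. A lax adjunction $(\eta,\theta,s,t)\colon F\dashv G\colon \mathbf B\rightleftarrows\mathbf C$ between pseudofunctors consists here of oplax natural transformations $\eta\colon 1\to GF$ and $\theta\colon FG\to 1$ (with comparisons $\eta_m\colon m\odot\eta_y\to\eta_x\odot GFm$ for $m\colon x\to y$ in $\mathbf B$, and $\theta_n\colon FGn\odot\theta_z\to\theta_y\odot n$ for $n\colon y\to z$ in $\mathbf C$) and invertible modifications $s\colon 1_F\cong (F*\eta)\odot(\theta*F)$ and $t\colon(\eta*G)\odot(G*\theta)\cong 1_G$ satisfying the two swallowtail identities: modulo structural isomorphisms, for every object $x$ of $\mathbf B$ the composite $$\eta_x\xrightarrow{\;t_{Fx}^{-1}\;}\eta_x\odot\eta_{GFx}\odot G\theta_{Fx}\xrightarrow{\;\eta_{\eta_x}\;}\eta_x\odot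 GF\eta_x\odot G\theta_{Fx}\xrightarrow{\;Gs_x^{-1}\;}\eta_x$$ is the identity, and for every object $y$ of $\mathbf C$ the composite $$\theta_y\xrightarrow{\;Ft_y^{-1}\;}F\eta_{Gy}\odot FG\theta_y\odot\theta_y\xrightarrow{\;\theta_{\theta_y}\;}F\eta_{Gy}\odot\theta_{FGy}\odot\theta_y\xrightarrow{\;s_{Gy}^{-1}\;}\theta_y$$ is the identity. It is a biadjunction if moreover $\eta$ and $\theta$ are pseudo natural, i.e. all their comparisons are invertible. **Statement.** Let $(\eta,\varepsilon)\colon F\dashv G\colon\mathbb D\rightleftarrows\mathbb E$ be a double adjunction between pseudo double functors such that every component arrow $\eta_x$ and $\varepsilon_y$ has a companion, and choose such companions. Then there is a lax adjunction $(\eta_!,\varepsilon_!,s,t)\colon F\dashv G\colon\mathbf D\rightleftarrows\mathbf E$ between the underlying bicategories, comprising the underlying pseudofunctors, oplax natural transformations and invertible modifications. Here $\eta_!$ has components the chosen companions $(\eta_x)_!$ and comparisons $(\eta_!)_m=(\eta_m)_!$ obtained from the component cells $\eta_m$, and likewise for $\varepsilon_!$. If, moreover, all component cells of $\eta$ and of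 $\varepsilon$ are commuters, then $\eta_!$ and $\varepsilon_!$ are pseudo natural, so this lax adjunction is a biadjunction comprising pseudofunctors, pseudo natural transformations and invertible modifications. -/

import Mathlib

open CategoryTheory Bicategory

universe c p v u c₁ p₁ v₁ u₁ c₂ p₂ v₂ u₂ c₃ p₃ v₃ u₃

/-! ## Double categories -/

/-- Objects and arrows forming a category, proarrows, and cells. A cell `α : Cell m n` has a
source arrow `src α` and a target arrow `tgt α`, so it is a square
```
      x --m--> y
      |        |
 src α|   α    | tgt α
      v        v
      w --n--> z
```
Cells are the morphisms of a category with respect to internal (vertical) composition, on which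
`src` and `tgt` are functors to the category of objects and arrows. -/
class CellCategory (D : Type u) extends Category.{v} D where
  /-- proarrows -/
  Pro : D → D → Type p
  /-- cells with a given top and bottom proarrow -/
  Cell : {x y w z : D} → Pro x y → Pro w z → Type c
  /-- the left-hand boundary arrow of a cell -/
  src : {x y w z : D} → {m : Pro x y} → {n : Pro w z} → Cell m n → (x ⟶ w)
  /-- the right-hand boundary arrow of a cell -/
  tgt : {x y w z : D} → {m : Pro x y} → {n : Pro w z} → Cell m n → (y ⟶ z)
  /-- internal identity cell `1_m` -/
  vid : {x y : D} → (m : Pro x y) → Cell m m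
  /-- internal composition of cells -/
  vcomp : {x y w z a b : D} → {m : Pro x y} → {n : Pro w z} → {k : Pro a b} →
    Cell m n → Cell n k → Cell m k
  src_vid : ∀ {x y : D} (m : Pro x y), src (vid m) = 𝟙 x
  tgt_vid : ∀ {x y : D} (m : Pro x y), tgt (vid m) = 𝟙 y
  src_vcomp : ∀ {x y w z a b : D} {m : Pro x y} {n : Pro w z} {k : Pro a b}
    (α : Cell m n) (β : Cell n k), src (vcomp α β) = src α ≫ src β
  tgt_vcomp : ∀ {x y w z a b : D} {m : Pro x y} {n : Pro w z} {k : Pro a b}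
    (α : Cell m n) (β : Cell n k), tgt (vcomp α β) = tgt α ≫ tgt β
  vid_vcomp : ∀ {x y w z : D} {m : Pro x y} {n : Pro w z} (α : Cell m n), vcomp (vid m) α = α
  vcomp_vid : ∀ {x y w z : D} {m : Pro x y} {n : Pro w z} (α : Cell m n), vcomp α (vid n) = α
  vcomp_assoc : ∀ {x y w z a b a' b' : D} {m : Pro x y} {n : Pro w z} {k : Pro a b}
    {l : Pro a' b'} (α : Cell m n) (β : Cell n k) (γ : Cell k l),
    vcomp (vcomp α β) γ = vcomp α (vcomp β γ)

namespace CellCategory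

attribute [simp] src_vid tgt_vid src_vcomp tgt_vcomp vid_vcomp vcomp_vid vcomp_assoc

/-- internal composition of cells, in diagrammatic order -/
infixr:80 " ⋆ " => CellCategory.vcomp

variable {D : Type u} [CellCategory.{c, p, v} D]

/-- A globular cell: a cell whose source and target arrows are identities. -/
@[ext] structure Globular {x y : D} (m n : Pro x y) where
  /-- the underlying cell -/
  cell : Cell m n
  src_cell : src cell = 𝟙 x
  tgt_cell : tgt cell = 𝟙 y

attribute [simp] Globular.src_cell Globular.tgt_cell

/-- Proarrows `x ⇸ y` and globular cells form a category. -/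
instance globularCategory (x y : D) : Category (Pro x y) where
  Hom m n := Globular m n
  id m := ⟨vid m, by simp, by simp⟩
  comp α β := ⟨α.cell ⋆ β.cell, by simp, by simp⟩
  id_comp α := Globular.ext (by simp)
  comp_id α := Globular.ext (by simp)
  assoc α β γ := Globular.ext (by simp)

/-- the underlying cell of a globular cell -/
abbrev cellOf {x y : D} {m n : Pro x y} (α : m ⟶ n) : Cell m n := Globular.cell α

@[ext] theorem glob_ext {x y : D} {m n : Pro x y} {α β : m ⟶ n} (h : cellOf α = cellOf β) :
    α = β := Globular.ext h

@[simp] theorem cellOf_id {x y : D} (m : Pro x y) : cellOf (𝟙 m) = vid m := rfl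

@[simp] theorem cellOf_comp {x y : D} {m n k : Pro x y} (α : m ⟶ n) (β : n ⟶ k) :
    cellOf (α ≫ β) = cellOf α ⋆ cellOf β := rfl

@[simp] theorem src_cellOf {x y : D} {m n : Pro x y} (α : m ⟶ n) : src (cellOf α) = 𝟙 x :=
  Globular.src_cell α

@[simp] theorem tgt_cellOf {x y : D} {m n : Pro x y} (α : m ⟶ n) : tgt (cellOf α) = 𝟙 y :=
  Globular.tgt_cell α

@[simp] theorem hom_vcomp_inv {x y : D} {m n : Pro x y} (e : m ≅ n) :
    cellOf e.hom ⋆ cellOf e.inv = vid m := by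
  rw [← cellOf_comp, e.hom_inv_id, cellOf_id]

@[simp] theorem inv_vcomp_hom {x y : D} {m n : Pro x y} (e : m ≅ n) :
    cellOf e.inv ⋆ cellOf e.hom = vid n := by
  rw [← cellOf_comp, e.inv_hom_id, cellOf_id]

@[simp] theorem hom_vcomp_inv_assoc {x y w z : D} {m n : Pro x y} {k : Pro w z} (e : m ≅ n)
    (α : Cell m k) : cellOf e.hom ⋆ cellOf e.inv ⋆ α = α := by
  rw [← vcomp_assoc, hom_vcomp_inv, vid_vcomp]

@[simp] theorem inv_vcomp_hom_assoc {x y w z : D} {m n : Pro x y} {k : Pro w z} (e : m ≅ n)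
    (α : Cell n k) : cellOf e.inv ⋆ cellOf e.hom ⋆ α = α := by
  rw [← vcomp_assoc, inv_vcomp_hom, vid_vcomp]

end CellCategory

open CellCategory

/-- A (pseudo) double category: external composition of proarrows and cells is associative and
unital up to coherent natural globular isomorphisms. The external composite `hcell α β h` of two
cells is defined when the target arrow of `α` is the source arrow of `β`. In the axioms, the
proofs `h` of composability are arguments; they can always be supplied from the equations for
sources and targets. -/
class DoubleCategory (D : Type u) [CellCategory.{c, p, v} D] where
  /-- external identity proarrow `id_x` -/
  hid : (x : D) → Pro x x
  /-- external identity cell `id_f` -/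
  hidCell : {x y : D} → (f : x ⟶ y) → Cell (hid x) (hid y)
  /-- external composition `m ⊙ n` of proarrows -/
  hcomp : {x y z : D} → Pro x y → Pro y z → Pro x z
  /-- external composition of cells -/
  hcell : {x y z x' y' z' : D} → {m : Pro x y} → {n : Pro y z} → {m' : Pro x' y'} →
    {n' : Pro y' z'} → (α : Cell m m') → (β : Cell n n') → tgt α = src β →
    Cell (hcomp m n) (hcomp m' n')
  src_hidCell : ∀ {x y : D} (f : x ⟶ y), src (hidCell f) = f
  tgt_hidCell : ∀ {x y : D} (f : x ⟶ y), tgt (hidCell f) = f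
  hidCell_id : ∀ x : D, hidCell (𝟙 x) = vid (hid x)
  hidCell_comp : ∀ {x y z : D} (f : x ⟶ y) (g : y ⟶ z),
    hidCell (f ≫ g) = hidCell f ⋆ hidCell g
  src_hcell : ∀ {x y z x' y' z' : D} {m : Pro x y} {n : Pro y z} {m' : Pro x' y'}
    {n' : Pro y' z'} (α : Cell m m') (β : Cell n n') (h : tgt α = src β),
    src (hcell α β h) = src α
  tgt_hcell : ∀ {x y z x' y' z' : D} {m : Pro x y} {n : Pro y z} {m' : Pro x' y'}
    {n' : Pro y' z'} (α : Cell m m') (β : Cell n n') (h : tgt α = src β),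
    tgt (hcell α β h) = tgt β
  hcell_vid : ∀ {x y z : D} (m : Pro x y) (n : Pro y z) (h : tgt (vid m) = src (vid n)),
    hcell (vid m) (vid n) h = vid (hcomp m n)
  /-- the interchange law -/
  hcell_vcomp : ∀ {x y z x' y' z' x'' y'' z'' : D} {m : Pro x y} {n : Pro y z}
    {m' : Pro x' y'} {n' : Pro y' z'} {m'' : Pro x'' y''} {n'' : Pro y'' z''}
    (α : Cell m m') (α' : Cell m' m'') (β : Cell n n') (β' : Cell n' n'')
    (h : tgt α = src β) (h' : tgt α' = src β') (h'' : tgt (α ⋆ α') = src (β ⋆ β')),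
    hcell (α ⋆ α') (β ⋆ β') h'' = hcell α β h ⋆ hcell α' β' h'
  /-- associators -/
  assoc' : {x y z w : D} → (m : Pro x y) → (n : Pro y z) → (k : Pro z w) →
    (hcomp (hcomp m n) k ≅ hcomp m (hcomp n k))
  /-- left unitors -/
  lunit : {x y : D} → (m : Pro x y) → (hcomp (hid x) m ≅ m)
  /-- right unitors -/
  runit : {x y : D} → (m : Pro x y) → (hcomp m (hid y) ≅ m)
  assoc_naturality : ∀ {x y z w x' y' z' w' : D} {m : Pro x y} {n : Pro y z} {k : Pro z w}
    {m' : Pro x' y'} {n' : Pro y' z'} {k' : Pro z' w'}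
    (α : Cell m m') (β : Cell n n') (γ : Cell k k') (h : tgt α = src β) (h' : tgt β = src γ)
    (h₁ : tgt (hcell α β h) = src γ) (h₂ : tgt α = src (hcell β γ h')),
    hcell (hcell α β h) γ h₁ ⋆ cellOf (assoc' m' n' k').hom =
      cellOf (assoc' m n k).hom ⋆ hcell α (hcell β γ h') h₂
  lunit_naturality : ∀ {x y x' y' : D} {m : Pro x y} {m' : Pro x' y'} (α : Cell m m')
    (h : tgt (hidCell (src α)) = src α),
    hcell (hidCell (src α)) α h ⋆ cellOf (lunit m').hom = cellOf (lunit m).hom ⋆ α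
  runit_naturality : ∀ {x y x' y' : D} {m : Pro x y} {m' : Pro x' y'} (α : Cell m m')
    (h : tgt α = src (hidCell (tgt α))),
    hcell α (hidCell (tgt α)) h ⋆ cellOf (runit m').hom = cellOf (runit m).hom ⋆ α
  pentagon' : ∀ {x y z w a : D} (m : Pro x y) (n : Pro y z) (k : Pro z w) (l : Pro w a)
    (h : tgt (cellOf (assoc' m n k).hom) = src (vid l))
    (h' : tgt (vid m) = src (cellOf (assoc' n k l).hom)),
    hcell (cellOf (assoc' m n k).hom) (vid l) h ⋆ cellOf (assoc' m (hcomp n k) l).hom ⋆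
        hcell (vid m) (cellOf (assoc' n k l).hom) h' =
      cellOf (assoc' (hcomp m n) k l).hom ⋆ cellOf (assoc' m n (hcomp k l)).hom
  triangle' : ∀ {x y z : D} (m : Pro x y) (n : Pro y z)
    (h : tgt (vid m) = src (cellOf (lunit n).hom))
    (h' : tgt (cellOf (runit m).hom) = src (vid n)),
    cellOf (assoc' m (hid y) n).hom ⋆ hcell (vid m) (cellOf (lunit n).hom) h =
      hcell (cellOf (runit m).hom) (vid n) h'

namespace DoubleCategory

attribute [simp] src_hidCell tgt_hidCell hidCell_id hidCell_comp src_hcell tgt_hcell hcell_vid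

/-- external composition of proarrows, in diagrammatic order -/
infixr:82 " ⊙ " => DoubleCategory.hcomp

variable {D : Type u} [CellCategory.{c, p, v} D] [DoubleCategory D]

/-- External composition of globular cells. -/
def hglob {x y z : D} {m m' : Pro x y} {n n' : Pro y z} (α : m ⟶ m') (β : n ⟶ n') :
    m ⊙ n ⟶ m' ⊙ n' :=
  Globular.mk (hcell (cellOf α) (cellOf β) (by simp)) (by simp) (by simp)

@[simp] theorem cellOf_hglob {x y z : D} {m m' : Pro x y} {n n' : Pro y z} (α : m ⟶ m')
    (β : n ⟶ n') : cellOf (hglob α β) = hcell (cellOf α) (cellOf β) (by simp) := rfl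

@[simp] theorem hglob_id {x y z : D} (m : Pro x y) (n : Pro y z) :
    hglob (𝟙 m) (𝟙 n) = 𝟙 (m ⊙ n) := by
  apply glob_ext; simp

theorem hglob_comp {x y z : D} {m m' m'' : Pro x y} {n n' n'' : Pro y z} (α : m ⟶ m')
    (α' : m' ⟶ m'') (β : n ⟶ n') (β' : n' ⟶ n'') :
    hglob (α ≫ α') (β ≫ β') = hglob α β ≫ hglob α' β' := by
  apply glob_ext
  simp only [cellOf_hglob, cellOf_comp]
  exact hcell_vcomp _ _ _ _ _ _ _

theorem hglob_assoc {x y z w : D} {m m' : Pro x y} {n n' : Pro y z} {k k' : Pro z w}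
    (α : m ⟶ m') (β : n ⟶ n') (γ : k ⟶ k') :
    hglob (hglob α β) γ ≫ (assoc' m' n' k').hom =
      (assoc' m n k).hom ≫ hglob α (hglob β γ) := by
  apply glob_ext
  simp only [cellOf_hglob, cellOf_comp]
  exact assoc_naturality _ _ _ _ _ _ _

theorem hcell_congr {x y z x' y' z' : D} {m : Pro x y} {n : Pro y z} {m' : Pro x' y'}
    {n' : Pro y' z'} {α α₁ : Cell m m'} {β β₁ : Cell n n'} (hα : α = α₁) (hβ : β = β₁)
    (h : tgt α = src β) (h₁ : tgt α₁ = src β₁) : hcell α β h = hcell α₁ β₁ h₁ := by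
  subst hα hβ; rfl

theorem lunit_hglob {x y : D} {m m' : Pro x y} (α : m ⟶ m') :
    hglob (𝟙 (hid x)) α ≫ (lunit m').hom = (lunit m).hom ≫ α := by
  apply glob_ext
  simp only [cellOf_hglob, cellOf_comp]
  rw [← lunit_naturality (cellOf α) (by simp)]
  congr 1
  exact hcell_congr (by simp) rfl _ _

theorem runit_hglob {x y : D} {m m' : Pro x y} (α : m ⟶ m') :
    hglob α (𝟙 (hid y)) ≫ (runit m').hom = (runit m).hom ≫ α := by
  apply glob_ext
  simp only [cellOf_hglob, cellOf_comp]
  rw [← runit_naturality (cellOf α) (by simp)]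
  congr 1
  exact hcell_congr rfl (by simp) _ _


theorem whiskerLeft_comp' {x y z : D} (m : Pro x y) {n n' n'' : Pro y z} (β : n ⟶ n')
    (β' : n' ⟶ n'') : hglob (𝟙 m) (β ≫ β') = hglob (𝟙 m) β ≫ hglob (𝟙 m) β' := by
  rw [← hglob_comp, Category.id_comp]

theorem comp_whiskerRight' {x y z : D} {m m' m'' : Pro x y} (α : m ⟶ m') (α' : m' ⟶ m'')
    (n : Pro y z) : hglob (α ≫ α') (𝟙 n) = hglob α (𝟙 n) ≫ hglob α' (𝟙 n) := by
  rw [← hglob_comp, Category.id_comp]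

theorem id_whiskerLeft' {x y : D} {m n : Pro x y} (β : m ⟶ n) :
    hglob (𝟙 (hid x)) β = (lunit m).hom ≫ β ≫ (lunit n).inv := by
  rw [← Category.assoc, Iso.eq_comp_inv, lunit_hglob]

theorem whiskerRight_id' {x y : D} {m n : Pro x y} (α : m ⟶ n) :
    hglob α (𝟙 (hid y)) = (runit m).hom ≫ α ≫ (runit n).inv := by
  rw [← Category.assoc, Iso.eq_comp_inv, runit_hglob]

theorem comp_whiskerLeft' {x y z w : D} (m : Pro x y) (n : Pro y z) {k k' : Pro z w}
    (β : k ⟶ k') : hglob (𝟙 (m ⊙ n)) β =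
      (assoc' m n k).hom ≫ hglob (𝟙 m) (hglob (𝟙 n) β) ≫ (assoc' m n k').inv := by
  rw [← Category.assoc, Iso.eq_comp_inv, ← hglob_assoc, hglob_id]

theorem whiskerRight_comp' {x y z w : D} {m m' : Pro x y} (α : m ⟶ m') (n : Pro y z)
    (k : Pro z w) : hglob α (𝟙 (n ⊙ k)) =
      (assoc' m n k).inv ≫ hglob (hglob α (𝟙 n)) (𝟙 k) ≫ (assoc' m' n k).hom := by
  rw [hglob_assoc, Iso.inv_hom_id_assoc, hglob_id]

theorem whisker_assoc' {x y z w : D} (m : Pro x y) {n n' : Pro y z} (β : n ⟶ n')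
    (k : Pro z w) : hglob (hglob (𝟙 m) β) (𝟙 k) =
      (assoc' m n k).hom ≫ hglob (𝟙 m) (hglob β (𝟙 k)) ≫ (assoc' m n' k).inv := by
  rw [← Category.assoc, Iso.eq_comp_inv, hglob_assoc]

theorem whisker_exchange' {x y z : D} {m n : Pro x y} {k l : Pro y z} (α : m ⟶ n)
    (β : k ⟶ l) : hglob (𝟙 m) β ≫ hglob α (𝟙 l) = hglob α (𝟙 k) ≫ hglob (𝟙 n) β := by
  rw [← hglob_comp, ← hglob_comp, Category.id_comp, Category.comp_id, Category.id_comp,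
    Category.comp_id]

/-- left whiskering of a globular cell -/
abbrev wl {x y z : D} (m : Pro x y) {n n' : Pro y z} (β : n ⟶ n') : m ⊙ n ⟶ m ⊙ n' :=
  hglob (𝟙 m) β

/-- right whiskering of a globular cell -/
abbrev wr {x y z : D} {m m' : Pro x y} (α : m ⟶ m') (n : Pro y z) : m ⊙ n ⟶ m' ⊙ n :=
  hglob α (𝟙 n)

theorem pentagon_glob {x y z w a : D} (m : Pro x y) (n : Pro y z) (k : Pro z w) (l : Pro w a) :
    wr (assoc' m n k).hom l ≫ (assoc' m (n ⊙ k) l).hom ≫ wl m (assoc' n k l).hom =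
      (assoc' (m ⊙ n) k l).hom ≫ (assoc' m n (k ⊙ l)).hom :=
  glob_ext (pentagon' m n k l (by simp) (by simp))

theorem triangle_glob {x y z : D} (m : Pro x y) (n : Pro y z) :
    (assoc' m (hid y) n).hom ≫ wl m (lunit n).hom = wr (runit m).hom n :=
  glob_ext (triangle' m n (by simp) (by simp))

end DoubleCategory

open DoubleCategory

/-! ## The underlying bicategory -/

/-- The underlying bicategory of a double category: same objects, with proarrows as 1-morphisms
and globular cells as 2-morphisms. -/
@[ext] structure UBicat (D : Type u) : Type u where
  /-- the object of the double category -/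
  as : D

namespace UBicat

variable {D : Type u} [CellCategory.{c, p, v} D] [DoubleCategory D]

instance : CategoryStruct.{p} (UBicat D) where
  Hom x y := Pro x.as y.as
  id x := hid x.as
  comp m n := m ⊙ n

instance : Bicategory.{c, p} (UBicat D) where
  homCategory x y := globularCategory x.as y.as
  whiskerLeft {x y z} m _ _ β := wl (x := x.as) (y := y.as) (z := z.as) m β
  whiskerRight {x y z} _ _ α n := wr (x := x.as) (y := y.as) (z := z.as) α n
  associator m n k := assoc' m n k
  leftUnitor m := lunit m
  rightUnitor m := runit m
  whiskerLeft_id m n := hglob_id m n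
  whiskerLeft_comp m _ _ _ β β' := whiskerLeft_comp' m β β'
  id_whiskerLeft β := id_whiskerLeft' β
  comp_whiskerLeft m n _ _ β := comp_whiskerLeft' m n β
  id_whiskerRight m n := hglob_id m n
  comp_whiskerRight α α' n := comp_whiskerRight' α α' n
  whiskerRight_id α := whiskerRight_id' α
  whiskerRight_comp α n k := whiskerRight_comp' α n k
  whisker_assoc m _ _ β k := whisker_assoc' m β k
  whisker_exchange α β := whisker_exchange' α β
  pentagon m n k l := pentagon_glob m n k l
  triangle m n := triangle_glob m n

end UBicat

/-! ## Double functors -/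

/-- A (pseudo) double functor: a functor on objects and arrows, a functorial action on proarrows
and cells, and coherent natural globular isomorphisms comparing external composites and
identities. -/
structure DoubleFunctor (D : Type u₁) [CellCategory.{c₁, p₁, v₁} D] [DoubleCategory D]
    (E : Type u₂) [CellCategory.{c₂, p₂, v₂} E] [DoubleCategory E] extends D ⥤ E where
  /-- action on proarrows -/
  mapPro : {x y : D} → Pro x y → Pro (obj x) (obj y)
  /-- action on cells -/
  mapCell : {x y w z : D} → {m : Pro x y} → {n : Pro w z} → Cell m n →
    Cell (mapPro m) (mapPro n)
  src_mapCell : ∀ {x y w z : D} {m : Pro x y} {n : Pro w z} (α : Cell m n),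
    src (mapCell α) = map (src α)
  tgt_mapCell : ∀ {x y w z : D} {m : Pro x y} {n : Pro w z} (α : Cell m n),
    tgt (mapCell α) = map (tgt α)
  mapCell_vid : ∀ {x y : D} (m : Pro x y), mapCell (vid m) = vid (mapPro m)
  mapCell_vcomp : ∀ {x y w z a b : D} {m : Pro x y} {n : Pro w z} {k : Pro a b}
    (α : Cell m n) (β : Cell n k), mapCell (α ⋆ β) = mapCell α ⋆ mapCell β
  /-- comparison isomorphisms for external composition -/
  mapComp : {x y z : D} → (m : Pro x y) → (n : Pro y z) →
    (mapPro m ⊙ mapPro n ≅ mapPro (m ⊙ n))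
  /-- comparison isomorphisms for external identities -/
  mapId : (x : D) → (hid (obj x) ≅ mapPro (hid x))
  mapComp_naturality : ∀ {x y z x' y' z' : D} {m : Pro x y} {n : Pro y z} {m' : Pro x' y'}
    {n' : Pro y' z'} (α : Cell m m') (β : Cell n n') (h : tgt α = src β)
    (h' : tgt (mapCell α) = src (mapCell β)),
    hcell (mapCell α) (mapCell β) h' ⋆ cellOf (mapComp m' n').hom =
      cellOf (mapComp m n).hom ⋆ mapCell (hcell α β h)
  mapId_naturality : ∀ {x y : D} (f : x ⟶ y),
    hidCell (map f) ⋆ cellOf (mapId y).hom = cellOf (mapId x).hom ⋆ mapCell (hidCell f)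
  map_assoc : ∀ {x y z w : D} (m : Pro x y) (n : Pro y z) (k : Pro z w)
    (h : tgt (cellOf (mapComp m n).hom) = src (vid (mapPro k)))
    (h' : tgt (vid (mapPro m)) = src (cellOf (mapComp n k).hom)),
    hcell (cellOf (mapComp m n).hom) (vid (mapPro k)) h ⋆ cellOf (mapComp (m ⊙ n) k).hom ⋆
        mapCell (cellOf (assoc' m n k).hom) =
      cellOf (assoc' (mapPro m) (mapPro n) (mapPro k)).hom ⋆
        hcell (vid (mapPro m)) (cellOf (mapComp n k).hom) h' ⋆ cellOf (mapComp m (n ⊙ k)).hom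
  map_lunit : ∀ {x y : D} (m : Pro x y)
    (h : tgt (cellOf (mapId x).hom) = src (vid (mapPro m))),
    hcell (cellOf (mapId x).hom) (vid (mapPro m)) h ⋆ cellOf (mapComp (hid x) m).hom ⋆
        mapCell (cellOf (lunit m).hom) =
      cellOf (lunit (mapPro m)).hom
  map_runit : ∀ {x y : D} (m : Pro x y)
    (h : tgt (vid (mapPro m)) = src (cellOf (mapId y).hom)),
    hcell (vid (mapPro m)) (cellOf (mapId y).hom) h ⋆ cellOf (mapComp m (hid y)).hom ⋆
        mapCell (cellOf (runit m).hom) =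
      cellOf (runit (mapPro m)).hom

namespace DoubleFunctor

attribute [simp] src_mapCell tgt_mapCell mapCell_vid mapCell_vcomp

section

variable {D : Type u₁} [CellCategory.{c₁, p₁, v₁} D] [DoubleCategory D]
  {E : Type u₂} [CellCategory.{c₂, p₂, v₂} E] [DoubleCategory E] (F : DoubleFunctor D E)

/-- The action of a double functor on globular cells. -/
def mapGlob {x y : D} {m n : Pro x y} (α : m ⟶ n) : F.mapPro m ⟶ F.mapPro n :=
  Globular.mk (F.mapCell (cellOf α)) (by simp) (by simp)

@[simp] theorem cellOf_mapGlob {x y : D} {m n : Pro x y} (α : m ⟶ n) :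
    cellOf (F.mapGlob α) = F.mapCell (cellOf α) := rfl

@[simp] theorem mapGlob_id {x y : D} (m : Pro x y) : F.mapGlob (𝟙 m) = 𝟙 (F.mapPro m) :=
  glob_ext (F.mapCell_vid m)

@[simp] theorem mapGlob_comp {x y : D} {m n k : Pro x y} (α : m ⟶ n) (β : n ⟶ k) :
    F.mapGlob (α ≫ β) = F.mapGlob α ≫ F.mapGlob β :=
  glob_ext (F.mapCell_vcomp (cellOf α) (cellOf β))

/-- The action of a double functor on invertible globular cells. -/
@[simps] def mapGlobIso {x y : D} {m n : Pro x y} (e : m ≅ n) : F.mapPro m ≅ F.mapPro n where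
  hom := F.mapGlob e.hom
  inv := F.mapGlob e.inv
  hom_inv_id := by rw [← mapGlob_comp, e.hom_inv_id, mapGlob_id]
  inv_hom_id := by rw [← mapGlob_comp, e.inv_hom_id, mapGlob_id]

theorem glob_hglob {x y z : D} {m m' : Pro x y} {n n' : Pro y z} (α : m ⟶ m') (β : n ⟶ n') :
    hglob (F.mapGlob α) (F.mapGlob β) ≫ (F.mapComp m' n').hom =
      (F.mapComp m n).hom ≫ F.mapGlob (hglob α β) :=
  glob_ext (F.mapComp_naturality (cellOf α) (cellOf β) (by simp) (by simp))

theorem glob_assoc {x y z w : D} (m : Pro x y) (n : Pro y z) (k : Pro z w) :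
    wr (F.mapComp m n).hom (F.mapPro k) ≫ (F.mapComp (m ⊙ n) k).hom ≫
        F.mapGlob (assoc' m n k).hom =
      (assoc' (F.mapPro m) (F.mapPro n) (F.mapPro k)).hom ≫
        wl (F.mapPro m) (F.mapComp n k).hom ≫ (F.mapComp m (n ⊙ k)).hom :=
  glob_ext (F.map_assoc m n k (by simp) (by simp))

theorem glob_lunit {x y : D} (m : Pro x y) :
    wr (F.mapId x).hom (F.mapPro m) ≫ (F.mapComp (hid x) m).hom ≫
      F.mapGlob (lunit m).hom = (lunit (F.mapPro m)).hom :=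
  glob_ext (F.map_lunit m (by simp))

theorem glob_runit {x y : D} (m : Pro x y) :
    wl (F.mapPro m) (F.mapId y).hom ≫ (F.mapComp m (hid y)).hom ≫
      F.mapGlob (runit m).hom = (runit (F.mapPro m)).hom :=
  glob_ext (F.map_runit m (by simp))

theorem wr_inv_hom {x y z : D} {m m' : Pro x y} (e : m ≅ m') (n : Pro y z) :
    wr e.inv n ≫ wr e.hom n = 𝟙 _ := by
  rw [← comp_whiskerRight', e.inv_hom_id, hglob_id]

theorem wl_hom_inv {x y z : D} (m : Pro x y) {n n' : Pro y z} (e : n ≅ n') :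
    wl m e.hom ≫ wl m e.inv = 𝟙 _ := by
  rw [← whiskerLeft_comp', e.hom_inv_id, hglob_id]

theorem wl_inv_hom {x y z : D} (m : Pro x y) {n n' : Pro y z} (e : n ≅ n') :
    wl m e.inv ≫ wl m e.hom = 𝟙 _ := by
  rw [← whiskerLeft_comp', e.inv_hom_id, hglob_id]

theorem glob_whiskerLeft {x y z : D} (m : Pro x y) {n n' : Pro y z} (β : n ⟶ n') :
    F.mapGlob (wl m β) =
      (F.mapComp m n).inv ≫ wl (F.mapPro m) (F.mapGlob β) ≫ (F.mapComp m n').hom := by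
  rw [Iso.eq_inv_comp, ← F.glob_hglob, F.mapGlob_id]

theorem glob_whiskerRight {x y z : D} {m m' : Pro x y} (α : m ⟶ m') (n : Pro y z) :
    F.mapGlob (wr α n) =
      (F.mapComp m n).inv ≫ wr (F.mapGlob α) (F.mapPro n) ≫ (F.mapComp m' n).hom := by
  rw [Iso.eq_inv_comp, ← F.glob_hglob, F.mapGlob_id]

theorem glob_assoc_eq {x y z w : D} (m : Pro x y) (n : Pro y z) (k : Pro z w) :
    F.mapGlob (assoc' m n k).hom =
      (F.mapComp (m ⊙ n) k).inv ≫ wr (F.mapComp m n).inv (F.mapPro k) ≫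
        (assoc' (F.mapPro m) (F.mapPro n) (F.mapPro k)).hom ≫
          wl (F.mapPro m) (F.mapComp n k).hom ≫ (F.mapComp m (n ⊙ k)).hom := by
  rw [← F.glob_assoc, ← Category.assoc (wr _ _), wr_inv_hom, Category.id_comp,
    Iso.inv_hom_id_assoc]

theorem glob_lunit_eq {x y : D} (m : Pro x y) :
    F.mapGlob (lunit m).hom =
      (F.mapComp (hid x) m).inv ≫ wr (F.mapId x).inv (F.mapPro m) ≫
        (lunit (F.mapPro m)).hom := by
  rw [← F.glob_lunit, ← Category.assoc (wr _ _), wr_inv_hom, Category.id_comp,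
    Iso.inv_hom_id_assoc]

theorem glob_runit_eq {x y : D} (m : Pro x y) :
    F.mapGlob (runit m).hom =
      (F.mapComp m (hid y)).inv ≫ wl (F.mapPro m) (F.mapId y).inv ≫
        (runit (F.mapPro m)).hom := by
  rw [← F.glob_runit, ← Category.assoc (wl _ _), wl_inv_hom, Category.id_comp,
    Iso.inv_hom_id_assoc]

/-- The pseudofunctor between underlying bicategories that has the same action on objects,
proarrows and globular cells and the same comparison isomorphisms. -/
def toPseudofunctor : UBicat D ⥤ᵖ UBicat E where
  obj x := ⟨F.obj x.as⟩
  map m := F.mapPro m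
  map₂ α := F.mapGlob α
  map₂_id m := F.mapGlob_id m
  map₂_comp α β := F.mapGlob_comp α β
  mapId x := (F.mapId x.as).symm
  mapComp m n := (F.mapComp m n).symm
  map₂_whisker_left m _ _ β := F.glob_whiskerLeft m β
  map₂_whisker_right α n := F.glob_whiskerRight α n
  map₂_associator m n k := F.glob_assoc_eq m n k
  map₂_left_unitor m := F.glob_lunit_eq m
  map₂_right_unitor m := F.glob_runit_eq m

theorem mapComp_wr {x y z : D} {m m' : Pro x y} (α : m ⟶ m') (n : Pro y z) :
    wr (F.mapGlob α) (F.mapPro n) ≫ (F.mapComp m' n).hom =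
      (F.mapComp m n).hom ≫ F.mapGlob (wr α n) := by
  rw [← F.glob_hglob, F.mapGlob_id]

theorem mapComp_wl {x y z : D} (m : Pro x y) {n n' : Pro y z} (β : n ⟶ n') :
    wl (F.mapPro m) (F.mapGlob β) ≫ (F.mapComp m n').hom =
      (F.mapComp m n).hom ≫ F.mapGlob (wl m β) := by
  rw [← F.glob_hglob, F.mapGlob_id]

end

section

variable {D : Type u₁} [CellCategory.{c₁, p₁, v₁} D] [DoubleCategory D]
    {E : Type u₂} [CellCategory.{c₂, p₂, v₂} E] [DoubleCategory E]
    {C : Type u₃} [CellCategory.{c₃, p₃, v₃} C] [DoubleCategory C]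
    (F : DoubleFunctor D E) (G : DoubleFunctor E C)

theorem comp_assoc_aux {x y z w : D} (m : Pro x y) (n : Pro y z) (k : Pro z w) :
    wr ((G.mapComp (F.mapPro m) (F.mapPro n)).hom ≫ G.mapGlob (F.mapComp m n).hom)
        (G.mapPro (F.mapPro k)) ≫
      ((G.mapComp (F.mapPro (m ⊙ n)) (F.mapPro k)).hom ≫
        G.mapGlob (F.mapComp (m ⊙ n) k).hom) ≫ G.mapGlob (F.mapGlob (assoc' m n k).hom) =
    (assoc' (G.mapPro (F.mapPro m)) (G.mapPro (F.mapPro n)) (G.mapPro (F.mapPro k))).hom ≫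
      wl (G.mapPro (F.mapPro m))
        ((G.mapComp (F.mapPro n) (F.mapPro k)).hom ≫ G.mapGlob (F.mapComp n k).hom) ≫
      (G.mapComp (F.mapPro m) (F.mapPro (n ⊙ k))).hom ≫
        G.mapGlob (F.mapComp m (n ⊙ k)).hom := by
  have h₁ := G.mapComp_wr (F.mapComp m n).hom (F.mapPro k)
  have h₂ := F.glob_assoc m n k
  have h₃ := G.glob_assoc (F.mapPro m) (F.mapPro n) (F.mapPro k)
  have h₄ := G.mapComp_wl (F.mapPro m) (F.mapComp n k).hom
  have h₅ := congrArg G.mapGlob h₂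
  simp only [mapGlob_comp] at h₅
  simp only [wr, wl] at *
  rw [comp_whiskerRight', whiskerLeft_comp']
  simp only [Category.assoc]
  rw [reassoc_of% h₁, h₅, reassoc_of% h₃, reassoc_of% h₄]

theorem comp_lunit_aux {x y : D} (m : Pro x y) :
    wr ((G.mapId (F.obj x)).hom ≫ G.mapGlob (F.mapId x).hom) (G.mapPro (F.mapPro m)) ≫
      ((G.mapComp (F.mapPro (hid x)) (F.mapPro m)).hom ≫
        G.mapGlob (F.mapComp (hid x) m).hom) ≫ G.mapGlob (F.mapGlob (lunit m).hom) =
    (lunit (G.mapPro (F.mapPro m))).hom := by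
  have h₁ := G.mapComp_wr (F.mapId x).hom (F.mapPro m)
  have h₂ := congrArg G.mapGlob (F.glob_lunit m)
  have h₃ := G.glob_lunit (F.mapPro m)
  simp only [mapGlob_comp] at h₂
  simp only [wr] at *
  rw [comp_whiskerRight']
  simp only [Category.assoc]
  rw [reassoc_of% h₁, h₂, h₃]

theorem comp_runit_aux {x y : D} (m : Pro x y) :
    wl (G.mapPro (F.mapPro m)) ((G.mapId (F.obj y)).hom ≫ G.mapGlob (F.mapId y).hom) ≫
      ((G.mapComp (F.mapPro m) (F.mapPro (hid y))).hom ≫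
        G.mapGlob (F.mapComp m (hid y)).hom) ≫ G.mapGlob (F.mapGlob (runit m).hom) =
    (runit (G.mapPro (F.mapPro m))).hom := by
  have h₁ := G.mapComp_wl (F.mapPro m) (F.mapId y).hom
  have h₂ := congrArg G.mapGlob (F.glob_runit m)
  have h₃ := G.glob_runit (F.mapPro m)
  simp only [mapGlob_comp] at h₂
  simp only [wl] at *
  rw [whiskerLeft_comp']
  simp only [Category.assoc]
  rw [reassoc_of% h₁, h₂, h₃]

end

/-- The identity double functor. -/
def id (D : Type u₁) [CellCategory.{c₁, p₁, v₁} D] [DoubleCategory D] : DoubleFunctor D D where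
  toFunctor := 𝟭 D
  mapPro m := m
  mapCell α := α
  src_mapCell _ := rfl
  tgt_mapCell _ := rfl
  mapCell_vid _ := rfl
  mapCell_vcomp _ _ := rfl
  mapComp m n := Iso.refl (m ⊙ n)
  mapId x := Iso.refl (hid x)
  mapComp_naturality _ _ _ _ := by simp
  mapId_naturality _ := by simp
  map_assoc _ _ _ _ _ := by simp
  map_lunit _ _ := by simp
  map_runit _ _ := by simp

/-- The composite of two double functors, in diagrammatic order. -/
def comp {D : Type u₁} [CellCategory.{c₁, p₁, v₁} D] [DoubleCategory D]
    {E : Type u₂} [CellCategory.{c₂, p₂, v₂} E] [DoubleCategory E]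
    {C : Type u₃} [CellCategory.{c₃, p₃, v₃} C] [DoubleCategory C]
    (F : DoubleFunctor D E) (G : DoubleFunctor E C) : DoubleFunctor D C where
  toFunctor := F.toFunctor ⋙ G.toFunctor
  mapPro m := G.mapPro (F.mapPro m)
  mapCell α := G.mapCell (F.mapCell α)
  src_mapCell _ := by simp
  tgt_mapCell _ := by simp
  mapCell_vid _ := by simp
  mapCell_vcomp _ _ := by simp
  mapComp m n := G.mapComp (F.mapPro m) (F.mapPro n) ≪≫
    G.mapGlobIso (F.mapComp m n)
  mapId x := G.mapId (F.obj x) ≪≫ G.mapGlobIso (F.mapId x)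
  mapComp_naturality α β h h' := by
    have hF : tgt (F.mapCell α) = src (F.mapCell β) := by simp [h]
    have h₁ := G.mapComp_naturality (F.mapCell α) (F.mapCell β) hF h'
    have h₂ := congrArg G.mapCell (F.mapComp_naturality α β h hF)
    simp only [mapCell_vcomp] at h₂
    simp only [Iso.trans_hom, mapGlobIso_hom, cellOf_comp, cellOf_mapGlob, vcomp_assoc]
    rw [← vcomp_assoc, h₁, vcomp_assoc, h₂]
  mapId_naturality f := by
    have h₁ := G.mapId_naturality (F.map f)
    have h₂ := congrArg G.mapCell (F.mapId_naturality f)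
    simp only [mapCell_vcomp] at h₂
    simp only [Iso.trans_hom, mapGlobIso_hom, cellOf_comp, cellOf_mapGlob, vcomp_assoc,
      Functor.comp_map]
    rw [← vcomp_assoc, h₁, vcomp_assoc, h₂]
  map_assoc m n k _ _ := congrArg cellOf (comp_assoc_aux F G m n k)
  map_lunit m _ := congrArg cellOf (comp_lunit_aux F G m)
  map_runit m _ := congrArg cellOf (comp_runit_aux F G m)

end DoubleFunctor

/-! ## Natural transformations and double adjunctions -/

/-- A natural transformation between double functors: arrows `α_x` and cells `α_m` with source
`α_x` and target `α_y`, natural in arrows and cells and compatible with external composition and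
identities. -/
structure DoubleNatTrans {D : Type u₁} [CellCategory.{c₁, p₁, v₁} D] [DoubleCategory D]
    {E : Type u₂} [CellCategory.{c₂, p₂, v₂} E] [DoubleCategory E]
    (F G : DoubleFunctor D E) extends NatTrans F.toFunctor G.toFunctor where
  /-- component cell at a proarrow -/
  appPro : {x y : D} → (m : Pro x y) → Cell (F.mapPro m) (G.mapPro m)
  src_appPro : ∀ {x y : D} (m : Pro x y), src (appPro m) = app x
  tgt_appPro : ∀ {x y : D} (m : Pro x y), tgt (appPro m) = app y
  cell_naturality : ∀ {x y w z : D} {m : Pro x y} {n : Pro w z} (α : Cell m n),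
    F.mapCell α ⋆ appPro n = appPro m ⋆ G.mapCell α
  appPro_hcomp : ∀ {x y z : D} (m : Pro x y) (n : Pro y z)
    (h : tgt (appPro m) = src (appPro n)),
    cellOf (F.mapComp m n).hom ⋆ appPro (m ⊙ n) =
      hcell (appPro m) (appPro n) h ⋆ cellOf (G.mapComp m n).hom
  appPro_hid : ∀ x : D,
    cellOf (F.mapId x).hom ⋆ appPro (hid x) = hidCell (app x) ⋆ cellOf (G.mapId x).hom

/-- A (pseudo) double adjunction `(η, ε) : F ⊣ G`, i.e. an adjunction in the 2-category of double
categories, double functors and natural transformations: natural transformations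
`η : 1 ⟶ G ∘ F` and `ε : F ∘ G ⟶ 1` satisfying the triangle identities strictly, on objects and
on proarrows. -/
structure DoubleAdjunction {D : Type u₁} [CellCategory.{c₁, p₁, v₁} D] [DoubleCategory D]
    {E : Type u₂} [CellCategory.{c₂, p₂, v₂} E] [DoubleCategory E]
    (F : DoubleFunctor D E) (G : DoubleFunctor E D) where
  /-- the unit -/
  unit : DoubleNatTrans (DoubleFunctor.id D) (F.comp G)
  /-- the counit -/
  counit : DoubleNatTrans (G.comp F) (DoubleFunctor.id E)
  left_triangle : ∀ x : D, F.map (unit.app x) ≫ counit.app (F.obj x) = 𝟙 (F.obj x)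
  left_triangle_pro : ∀ {x y : D} (m : Pro x y),
    F.mapCell (unit.appPro m) ⋆ counit.appPro (F.mapPro m) = vid (F.mapPro m)
  right_triangle : ∀ y : E, unit.app (G.obj y) ≫ G.map (counit.app y) = 𝟙 (G.obj y)
  right_triangle_pro : ∀ {x y : E} (n : Pro x y),
    unit.appPro (G.mapPro n) ⋆ G.mapCell (counit.appPro n) = vid (G.mapPro n)

/-! ## Companions -/

section Companions

variable {D : Type u} [CellCategory.{c, p, v} D] [DoubleCategory D]

/-- A companion of an arrow `f : x ⟶ y`: a proarrow `f_! : x ⇸ y` with binding cells `unit` and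
`counit` such that `unit ⊙ counit = 1` (up to the unit isomorphisms) and
`unit ⋆ counit = id_f`. -/
structure Companion {x y : D} (f : x ⟶ y) where
  /-- the companion proarrow -/
  pro : Pro x y
  /-- the unit cell -/
  unit : Cell (hid x) pro
  /-- the counit cell -/
  counit : Cell pro (hid y)
  src_unit : src unit = 𝟙 x
  tgt_unit : tgt unit = f
  src_counit : src counit = f
  tgt_counit : tgt counit = 𝟙 y
  unit_hcell_counit : ∀ h : tgt unit = src counit,
    hcell unit counit h ⋆ cellOf (runit pro).hom = cellOf (lunit pro).hom
  unit_vcomp_counit : unit ⋆ counit = hidCell f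

/-- Sliding: given companions of `f : x ⟶ w` and `g : y ⟶ z`, a cell `α` from `m : x ⇸ y` to
`n : w ⇸ z` with source `f` and target `g` is reshaped into the globular cell
`α_! : m ⊙ g_! ⟶ f_! ⊙ n` obtained by pasting `α` with the unit of `f_!` on the left and with the
counit of `g_!` on the right. -/
def slide {x y w z : D} {f : x ⟶ w} {g : y ⟶ z} (cf : Companion f) (cg : Companion g)
    {m : Pro x y} {n : Pro w z} (α : Cell m n) (hs : src α = f) (ht : tgt α = g) :
    m ⊙ cg.pro ⟶ cf.pro ⊙ n :=
  wr (lunit m).inv cg.pro ≫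
    Globular.mk
      (hcell (hcell cf.unit α (cf.tgt_unit.trans hs.symm)) cg.counit
        ((tgt_hcell _ _ _).trans (ht.trans cg.src_counit.symm)))
      (by simp [cf.src_unit]) (by simp [cg.tgt_counit]) ≫
    (runit (cf.pro ⊙ n)).hom

/-- A cell whose source and target arrows have (chosen) companions is a commuter if the globular
cell obtained from it by sliding is invertible. -/
def IsCommuter {x y w z : D} {f : x ⟶ w} {g : y ⟶ z} (cf : Companion f) (cg : Companion g)
    {m : Pro x y} {n : Pro w z} (α : Cell m n) (hs : src α = f) (ht : tgt α = g) : Prop :=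
  IsIso (slide cf cg α hs ht)

end Companions

section Transpose

variable {D : Type u₁} [CellCategory.{c₁, p₁, v₁} D] [DoubleCategory D]
  {E : Type u₂} [CellCategory.{c₂, p₂, v₂} E] [DoubleCategory E] {F G : DoubleFunctor D E}

/-- All the component cells of a natural transformation, whose component arrows have companions,
are commuters. -/
def DoubleNatTrans.HasCommuterCells (α : DoubleNatTrans F G)
    (comp : ∀ x, Companion (α.app x)) : Prop :=
  ∀ {x y : D} (m : Pro x y),
    IsCommuter (comp x) (comp y) (α.appPro m) (α.src_appPro m) (α.tgt_appPro m)

/-- The data `(app, nat)` of an oplax natural transformation between the underlying pseudofunctors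
is the transpose `α_!` of the natural transformation `α` with respect to chosen companions of the
component arrows: the component at `x` is the companion `(α_x)_!`, and the naturality comparison at
a proarrow `m` is obtained from the component cell `α_m` by sliding. -/
def DoubleNatTrans.IsTranspose (α : DoubleNatTrans F G) (comp : ∀ x, Companion (α.app x))
    (app : ∀ x : D, Pro (F.obj x) (G.obj x))
    (nat : ∀ {x y : D} (m : Pro x y), F.mapPro m ⊙ app y ⟶ app x ⊙ G.mapPro m) : Prop :=
  ∃ h : ∀ x, app x = (comp x).pro, ∀ {x y : D} (m : Pro x y),
    nat m ≫ wr (eqToHom (h x)) (G.mapPro m) =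
      wl (F.mapPro m) (eqToHom (h y)) ≫
        slide (comp x) (comp y) (α.appPro m) (α.src_appPro m) (α.tgt_appPro m)

end Transpose

/-! ## Lax adjunctions between bicategories -/

namespace LaxAdj

section Aux

variable {B : Type u₁} [Bicategory.{c₁, v₁} B] {C : Type u₂} [Bicategory.{c₂, v₂} C]

theorem pre_id {a b : B} {f : a ⟶ a} {f' : b ⟶ b} {f₁ : a ⟶ a} {f₁' : b ⟶ b} {p : a ⟶ b}
    {n : f ≫ p ⟶ p ≫ f'} {n₁ : f₁ ≫ p ⟶ p ≫ f₁'} {I : f ⟶ f₁} {I' : f' ⟶ f₁'}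
    {i : f₁ ⟶ 𝟙 a} {i' : f₁' ⟶ 𝟙 b} (h₁ : I ▷ p ≫ n₁ = n ≫ p ◁ I')
    (h₂ : n₁ ≫ p ◁ i' = i ▷ p ≫ (λ_ p).hom ≫ (ρ_ p).inv) {j : f ⟶ 𝟙 a} {j' : f' ⟶ 𝟙 b}
    (hj : j = I ≫ i) (hj' : j' = I' ≫ i') :
    n ≫ p ◁ j' = j ▷ p ≫ (λ_ p).hom ≫ (ρ_ p).inv := by
  subst hj hj'
  rw [whiskerLeft_comp, ← reassoc_of% h₁, h₂, comp_whiskerRight, Category.assoc]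

theorem pre_comp {a b c a' b' c' : B} {k k₁ : a ⟶ c} {k' k₁' : a' ⟶ c'} {f : a ⟶ b} {g : b ⟶ c}
    {f' : a' ⟶ b'} {g' : b' ⟶ c'} {p : a ⟶ a'} {q : b ⟶ b'} {r : c ⟶ c'}
    {nk : k ≫ r ⟶ p ≫ k'} {nk₁ : k₁ ≫ r ⟶ p ≫ k₁'} {nf : f ≫ q ⟶ p ≫ f'}
    {ng : g ≫ r ⟶ q ≫ g'} {I : k ⟶ k₁} {I' : k' ⟶ k₁'} {i : k₁ ⟶ f ≫ g} {i' : k₁' ⟶ f' ≫ g'}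
    (h₁ : I ▷ r ≫ nk₁ = nk ≫ p ◁ I')
    (h₂ : nk₁ ≫ p ◁ i' = i ▷ r ≫ (α_ _ _ _).hom ≫ f ◁ ng ≫ (α_ _ _ _).inv ≫ nf ▷ g' ≫
      (α_ _ _ _).hom) {j : k ⟶ f ≫ g} {j' : k' ⟶ f' ≫ g'} (hj : j = I ≫ i) (hj' : j' = I' ≫ i') :
    nk ≫ p ◁ j' = j ▷ r ≫ (α_ _ _ _).hom ≫ f ◁ ng ≫ (α_ _ _ _).inv ≫ nf ▷ g' ≫
      (α_ _ _ _).hom := by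
  subst hj hj'
  rw [whiskerLeft_comp, ← reassoc_of% h₁, h₂, comp_whiskerRight, Category.assoc]

variable (H : B ⥤ᵖ C)

/-- The image under a pseudofunctor of a 2-morphism between composites. -/
abbrev mapSq {a b a' b' : B} {f : a ⟶ b} {q : b ⟶ b'} {p : a ⟶ a'} {f' : a' ⟶ b'}
    (n : f ≫ q ⟶ p ≫ f') : H.map f ≫ H.map q ⟶ H.map p ≫ H.map f' :=
  (H.mapComp f q).inv ≫ H.map₂ n ≫ (H.mapComp p f').hom

theorem post_naturality {a b a' b' : B} {f g : a ⟶ b} {f' g' : a' ⟶ b'} {p : a ⟶ a'}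
    {q : b ⟶ b'} {β : f ⟶ g} {β' : f' ⟶ g'} {nf : f ≫ q ⟶ p ≫ f'} {ng : g ≫ q ⟶ p ≫ g'}
    (h : β ▷ q ≫ ng = nf ≫ p ◁ β') :
    H.map₂ β ▷ H.map q ≫ mapSq H ng = mapSq H nf ≫ H.map p ◁ H.map₂ β' := by
  have h' := congrArg H.map₂ h
  simp only [PrelaxFunctor.map₂_comp, Pseudofunctor.map₂_whisker_right,
    Pseudofunctor.map₂_whisker_left, Category.assoc] at h'
  rw [← cancel_epi (H.mapComp f q).hom, ← cancel_mono (H.mapComp p g').inv]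
  simpa [mapSq] using h'

theorem post_id {a b : B} {f : a ⟶ a} {f' : b ⟶ b} {p : a ⟶ b}
    {n : f ≫ p ⟶ p ≫ f'} {i : f ⟶ 𝟙 a} {i' : f' ⟶ 𝟙 b}
    (h : n ≫ p ◁ i' = i ▷ p ≫ (λ_ p).hom ≫ (ρ_ p).inv)
    {j : H.map f ⟶ 𝟙 (H.obj a)} {j' : H.map f' ⟶ 𝟙 (H.obj b)}
    (hj : j = H.map₂ i ≫ (H.mapId a).hom) (hj' : j' = H.map₂ i' ≫ (H.mapId b).hom) :
    mapSq H n ≫ H.map p ◁ j' = j ▷ H.map p ≫ (λ_ (H.map p)).hom ≫ (ρ_ (H.map p)).inv := by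
  subst hj hj'
  have h' := congrArg H.map₂ h
  simp only [PrelaxFunctor.map₂_comp, Pseudofunctor.map₂_whisker_right,
    Pseudofunctor.map₂_whisker_left, Category.assoc] at h'
  have hr : H.map₂ (ρ_ p).inv ≫ (H.mapComp p (𝟙 b)).hom ≫ H.map p ◁ (H.mapId b).hom =
      (ρ_ (H.map p)).inv := by
    rw [← cancel_epi (H.map₂ (ρ_ p).hom), ← PrelaxFunctor.map₂_comp_assoc, Iso.hom_inv_id,
      PrelaxFunctor.map₂_id, Category.id_comp, Pseudofunctor.map₂_right_unitor]
    simp only [Category.assoc, Iso.hom_inv_id, Category.comp_id]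
  have hl : (H.mapComp (𝟙 a) p).inv ≫ H.map₂ (λ_ p).hom =
      (H.mapId a).hom ▷ H.map p ≫ (λ_ (H.map p)).hom := by
    rw [Pseudofunctor.map₂_left_unitor, Iso.inv_hom_id_assoc]
  rw [← Category.assoc, ← Category.assoc, Iso.comp_inv_eq] at h'
  simp only [Category.assoc] at h'
  simp only [mapSq, whiskerLeft_comp, comp_whiskerRight, Category.assoc]
  rw [reassoc_of% h', hr, reassoc_of% hl, Iso.inv_hom_id_assoc]

theorem map_assoc_hom {a b c d : B} (f : a ⟶ b) (g : b ⟶ c) (h : c ⟶ d) :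
    (H.mapComp (f ≫ g) h).inv ≫ H.map₂ (α_ f g h).hom ≫ (H.mapComp f (g ≫ h)).hom =
      (H.mapComp f g).hom ▷ H.map h ≫ (α_ _ _ _).hom ≫ H.map f ◁ (H.mapComp g h).inv := by
  rw [Pseudofunctor.map₂_associator]
  simp only [Category.assoc, Iso.inv_hom_id, Iso.inv_hom_id_assoc, Category.comp_id]

theorem map_assoc_inv {a b c d : B} (f : a ⟶ b) (g : b ⟶ c) (h : c ⟶ d) :
    (H.mapComp f (g ≫ h)).inv ≫ H.map₂ (α_ f g h).inv ≫ (H.mapComp (f ≫ g) h).hom =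
      H.map f ◁ (H.mapComp g h).hom ≫ (α_ _ _ _).inv ≫ (H.mapComp f g).inv ▷ H.map h := by
  have e : (H.mapComp (f ≫ g) h).symm ≪≫ H.map₂Iso (α_ f g h) ≪≫ H.mapComp f (g ≫ h) =
      whiskerRightIso (H.mapComp f g) (H.map h) ≪≫ α_ _ _ _ ≪≫
        whiskerLeftIso (H.map f) (H.mapComp g h).symm := Iso.ext (map_assoc_hom H f g h)
  have e' := congrArg Iso.inv e
  simpa only [Iso.trans_inv, Iso.symm_inv, PrelaxFunctor.map₂Iso_inv, whiskerRightIso_inv,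
    whiskerLeftIso_inv, Category.assoc] using e'

theorem post_comp {a b c a' b' c' : B} {k : a ⟶ c} {k' : a' ⟶ c'} {f : a ⟶ b} {g : b ⟶ c}
    {f' : a' ⟶ b'} {g' : b' ⟶ c'} {p : a ⟶ a'} {q : b ⟶ b'} {r : c ⟶ c'}
    {nk : k ≫ r ⟶ p ≫ k'} {nf : f ≫ q ⟶ p ≫ f'}
    {ng : g ≫ r ⟶ q ≫ g'} {i : k ⟶ f ≫ g} {i' : k' ⟶ f' ≫ g'}
    (h : nk ≫ p ◁ i' = i ▷ r ≫ (α_ _ _ _).hom ≫ f ◁ ng ≫ (α_ _ _ _).inv ≫ nf ▷ g' ≫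
      (α_ _ _ _).hom) {j : H.map k ⟶ H.map f ≫ H.map g} {j' : H.map k' ⟶ H.map f' ≫ H.map g'}
    (hj : j = H.map₂ i ≫ (H.mapComp f g).hom) (hj' : j' = H.map₂ i' ≫ (H.mapComp f' g').hom) :
    mapSq H nk ≫ H.map p ◁ j' = j ▷ H.map r ≫ (α_ _ _ _).hom ≫ H.map f ◁ mapSq H ng ≫
      (α_ _ _ _).inv ≫ mapSq H nf ▷ H.map g' ≫ (α_ _ _ _).hom := by
  subst hj hj'
  have h' := congrArg H.map₂ h
  simp only [PrelaxFunctor.map₂_comp, Pseudofunctor.map₂_whisker_right,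
    Pseudofunctor.map₂_whisker_left, Category.assoc] at h'
  rw [← Category.assoc, ← Category.assoc, Iso.comp_inv_eq] at h'
  simp only [Category.assoc] at h'
  simp only [mapSq, whiskerLeft_comp, comp_whiskerRight, Category.assoc]
  rw [reassoc_of% h', Iso.inv_hom_id_assoc]
  congr 1
  rw [reassoc_of% map_assoc_hom H f g r, reassoc_of% map_assoc_inv H f q g',
    reassoc_of% map_assoc_hom H p f' g', ← whiskerLeft_comp, Iso.inv_hom_id, whiskerLeft_id,
    Category.comp_id]

theorem map₂_id_comp {a b : B} (f : a ⟶ b) {k : H.obj a ⟶ H.obj b} (X : H.map f ⟶ k) :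
    X = H.map₂ (𝟙 f) ≫ X := by
  rw [PrelaxFunctor.map₂_id, Category.id_comp]

theorem map₂_comp_comp {a b : B} {f g h : a ⟶ b} (β : f ⟶ g) (γ : g ⟶ h)
    {k : H.obj a ⟶ H.obj b} (X : H.map h ⟶ k) :
    H.map₂ (β ≫ γ) ≫ X = H.map₂ β ≫ H.map₂ γ ≫ X := by
  rw [PrelaxFunctor.map₂_comp, Category.assoc]

end Aux

variable {B : Type u₁} [Bicategory.{c₁, v₁} B] {C : Type u₂} [Bicategory.{c₂, v₂} C]

/-- Oplax natural transformations between pseudofunctors. -/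
abbrev Opl (F G : B ⥤ᵖ C) := Oplax.OplaxTrans F.toOplax G.toOplax

variable {F : B ⥤ᵖ C} {G : C ⥤ᵖ B}

/-- The whiskering `F * η : F ⟶ F G F` of an oplax transformation `η : 1 ⟶ G F`. -/
def unitPost (η : Opl (Pseudofunctor.id B) (F.comp G)) : Opl F ((F.comp G).comp F) where
  app x := F.map (η.app x)
  naturality m := mapSq F (η.naturality m)
  naturality_naturality β := post_naturality F (η.naturality_naturality β)
  naturality_id x := post_id F (η.naturality_id x) (map₂_id_comp F _ _) rfl
  naturality_comp f g := post_comp F (η.naturality_comp f g) (map₂_id_comp F _ _) rfl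

/-- The whiskering `θ * F : F G F ⟶ F` of an oplax transformation `θ : F G ⟶ 1`. -/
def counitPre (θ : Opl (G.comp F) (Pseudofunctor.id C)) : Opl ((F.comp G).comp F) F where
  app x := θ.app (F.obj x)
  naturality m := θ.naturality (F.map m)
  naturality_naturality β := θ.naturality_naturality (F.map₂ β)
  naturality_id x := pre_id (θ.naturality_naturality (F.mapId x).hom)
    (θ.naturality_id (F.obj x)) (map₂_comp_comp F _ _ _) (Category.comp_id _).symm
  naturality_comp f g := pre_comp (θ.naturality_naturality (F.mapComp f g).hom)
    (θ.naturality_comp (F.map f) (F.map g)) (map₂_comp_comp F _ _ _) (Category.comp_id _).symm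

/-- The whiskering `η * G : G ⟶ G F G` of an oplax transformation `η : 1 ⟶ G F`. -/
def unitPre (η : Opl (Pseudofunctor.id B) (F.comp G)) : Opl G ((G.comp F).comp G) where
  app y := η.app (G.obj y)
  naturality n := η.naturality (G.map n)
  naturality_naturality β := η.naturality_naturality (G.map₂ β)
  naturality_id x := pre_id (η.naturality_naturality (G.mapId x).hom)
    (η.naturality_id (G.obj x)) (Category.comp_id _).symm (map₂_comp_comp G _ _ _)
  naturality_comp f g := pre_comp (η.naturality_naturality (G.mapComp f g).hom)
    (η.naturality_comp (G.map f) (G.map g)) (Category.comp_id _).symm (map₂_comp_comp G _ _ _)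

/-- The whiskering `G * θ : G F G ⟶ G` of an oplax transformation `θ : F G ⟶ 1`. -/
def counitPost (θ : Opl (G.comp F) (Pseudofunctor.id C)) : Opl ((G.comp F).comp G) G where
  app y := G.map (θ.app y)
  naturality n := mapSq G (θ.naturality n)
  naturality_naturality β := post_naturality G (θ.naturality_naturality β)
  naturality_id x := post_id G (θ.naturality_id x) rfl (map₂_id_comp G _ _)
  naturality_comp f g := post_comp G (θ.naturality_comp f g) rfl (map₂_id_comp G _ _)

section

open scoped Oplax.OplaxTrans

/-- The composite oplax transformation `(F * η) ≫ (θ * F) : F ⟶ F G F ⟶ F`. -/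
def leftZigzag (η : Opl (Pseudofunctor.id B) (F.comp G)) (θ : Opl (G.comp F) (Pseudofunctor.id C)) :
    F.toOplax ⟶ F.toOplax :=
  Oplax.OplaxTrans.vcomp (unitPost η) (counitPre θ)

/-- The composite oplax transformation `(η * G) ≫ (G * θ) : G ⟶ G F G ⟶ G`. -/
def rightZigzag (η : Opl (Pseudofunctor.id B) (F.comp G))
    (θ : Opl (G.comp F) (Pseudofunctor.id C)) : G.toOplax ⟶ G.toOplax :=
  Oplax.OplaxTrans.vcomp (unitPre η) (counitPost θ)

end

end LaxAdj

open scoped Oplax.OplaxTrans in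
/-- A lax adjunction between pseudofunctors `F : B ⟶ C` and `G : C ⟶ B`: oplax natural
transformations `η : 1 ⟶ G F` (the unit) and `θ : F G ⟶ 1` (the counit) and invertible
modifications `s : 1 ≅ (F * η) ≫ (θ * F)` and `t : (η * G) ≫ (G * θ) ≅ 1` (the triangulators)
satisfying the two swallowtail identities.

The first swallowtail identity says that the composite
`η_x ⟶ η_x ≫ (η_{GFx} ≫ G θ_{Fx}) ⟶ (η_x ≫ GF η_x) ≫ G θ_{Fx} ⟶ η_x ≫ G (F η_x ≫ θ_{Fx}) ⟶ η_x`
of `t_{Fx}⁻¹`, the naturality comparison of `η` at `η_x`, and `G s_x⁻¹` is the identity, and the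
second says that the composite
`θ_y ⟶ F (η_{Gy} ≫ G θ_y) ≫ θ_y ⟶ F η_{Gy} ≫ (FG θ_y ≫ θ_y) ⟶ (F η_{Gy} ≫ θ_{FGy}) ≫ θ_y ⟶ θ_y`
of `F t_y⁻¹`, the naturality comparison of `θ` at `θ_y`, and `s_{Gy}⁻¹` is the identity. -/
structure LaxAdjunction {B : Type u₁} [Bicategory.{c₁, v₁} B] {C : Type u₂}
    [Bicategory.{c₂, v₂} C] (F : B ⥤ᵖ C) (G : C ⥤ᵖ B) where
  /-- the unit -/
  unit : LaxAdj.Opl (Pseudofunctor.id B) (F.comp G)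
  /-- the counit -/
  counit : LaxAdj.Opl (G.comp F) (Pseudofunctor.id C)
  /-- the first triangulator -/
  s : 𝟙 F.toOplax ≅ LaxAdj.leftZigzag unit counit
  /-- the second triangulator -/
  t : LaxAdj.rightZigzag unit counit ≅ 𝟙 G.toOplax
  swallowtail_unit : ∀ x : B,
    (ρ_ (unit.app x)).inv ≫ unit.app x ◁ t.inv.as.app (F.obj x) ≫
      (α_ (unit.app x) (unit.app (G.obj (F.obj x))) (G.map (counit.app (F.obj x)))).inv ≫
      unit.naturality (unit.app x) ▷ G.map (counit.app (F.obj x)) ≫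
      (α_ (unit.app x) (G.map (F.map (unit.app x))) (G.map (counit.app (F.obj x)))).hom ≫
      unit.app x ◁ ((G.mapComp (F.map (unit.app x)) (counit.app (F.obj x))).inv ≫
        G.map₂ (s.inv.as.app x) ≫ (G.mapId (F.obj x)).hom) ≫
      (ρ_ (unit.app x)).hom = 𝟙 (unit.app x)
  swallowtail_counit : ∀ y : C,
    (λ_ (counit.app y)).inv ≫
      ((F.mapId (G.obj y)).inv ≫ F.map₂ (t.inv.as.app y) ≫
        (F.mapComp (unit.app (G.obj y)) (G.map (counit.app y))).hom) ▷ counit.app y ≫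
      (α_ (F.map (unit.app (G.obj y))) (F.map (G.map (counit.app y))) (counit.app y)).hom ≫
      F.map (unit.app (G.obj y)) ◁ counit.naturality (counit.app y) ≫
      (α_ (F.map (unit.app (G.obj y))) (counit.app (F.obj (G.obj y))) (counit.app y)).inv ≫
      s.inv.as.app (G.obj y) ▷ counit.app y ≫
      (λ_ (counit.app y)).hom = 𝟙 (counit.app y)

/-- A lax adjunction is a biadjunction if its unit and counit are pseudo natural, i.e. if their
naturality comparisons are invertible. -/
structure LaxAdjunction.IsBiadjunction {B : Type u₁} [Bicategory.{c₁, v₁} B] {C : Type u₂}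
    [Bicategory.{c₂, v₂} C] {F : B ⥤ᵖ C} {G : C ⥤ᵖ B} (A : LaxAdjunction F G) : Prop where
  isIso_unit : ∀ {x y : B} (m : x ⟶ y), IsIso (A.unit.naturality m)
  isIso_counit : ∀ {x y : C} (n : x ⟶ y), IsIso (A.counit.naturality n)

/-!
Pasting a proarrow `m` with the unit of a companion `f_!` gives an opcartesian cell
`m ⟶ m ⊙ f_!`, so the globular cell `α_! : m ⊙ g_! ⟶ f_! ⊙ n` is the only one whose composite with
the opcartesian cell of `g_!` is `α` pasted with the unit of `f_!`. This characterization makes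
`α ↦ α_!` functorial in both directions and compatible with double functors. Hence the oplax
naturality of `η_!` and `ε_!` is the image of the naturality of `η` and `ε`, and the triangle
identities for cells become the naturality conditions for `s` and `t⁻¹`, whose components identify
`id` with a companion of an identity arrow. The same uniqueness shows that a globular endomorphism
of a companion fixing its unit is the identity. All factors of the swallowtail composites preserve
units of companions, so these composites are identities.
-/

attribute [simp] Companion.src_unit Companion.tgt_unit Companion.src_counit Companion.tgt_counit
  DoubleNatTrans.src_appPro DoubleNatTrans.tgt_appPro

/-- External composition of cells, in diagrammatic order, with the composability proof supplied by
the simplifier. -/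
local notation:82 α:82 " ◫ " β:83 => DoubleCategory.hcell α β (by simp [*])

namespace CellCategory

variable {D : Type u} [CellCategory.{c, p, v} D]

theorem vcomp_reassoc {x y w z a b a' b' : D} {m : Pro x y} {n : Pro w z} {k : Pro a b}
    {l : Pro a' b'} {α : Cell m n} {β : Cell n k} {γ : Cell m k} (h : α ⋆ β = γ) (δ : Cell k l) :
    α ⋆ β ⋆ δ = γ ⋆ δ := by
  rw [← vcomp_assoc, h]

theorem inv_vcomp_eq_vcomp_inv {x y w z : D} {m n : Pro x y} {m' n' : Pro w z} {e : m ≅ n}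
    {e' : m' ≅ n'} {α : Cell m m'} {β : Cell n n'}
    (h : α ⋆ cellOf e'.hom = cellOf e.hom ⋆ β) :
    cellOf e.inv ⋆ α = β ⋆ cellOf e'.inv := by
  calc cellOf e.inv ⋆ α
      = cellOf e.inv ⋆ (α ⋆ cellOf e'.hom) ⋆ cellOf e'.inv := by simp
    _ = β ⋆ cellOf e'.inv := by rw [h]; simp

end CellCategory

namespace DoubleCategory

variable {D : Type u} [CellCategory.{c, p, v} D] [DoubleCategory D]

section Interchange

variable {x y z x' y' z' x'' y'' z'' : D} {m : Pro x y} {n : Pro y z} {m' : Pro x' y'}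
  {n' : Pro y' z'} {m'' : Pro x'' y''} {n'' : Pro y'' z''}

theorem hcell_vcomp_hcell (α : Cell m m') (α' : Cell m' m'') (β : Cell n n') (β' : Cell n' n'')
    (h : tgt α = src β) (h' : tgt α' = src β') :
    hcell α β h ⋆ hcell α' β' h' = hcell (α ⋆ α') (β ⋆ β') (by simp [h, h']) :=
  (hcell_vcomp α α' β β' h h' _).symm

theorem hcell_vcomp_hcell_assoc {a b : D} {k : Pro a b} (α : Cell m m') (α' : Cell m' m'')
    (β : Cell n n') (β' : Cell n' n'') (h : tgt α = src β) (h' : tgt α' = src β')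
    (γ : Cell (m'' ⊙ n'') k) :
    hcell α β h ⋆ hcell α' β' h' ⋆ γ = hcell (α ⋆ α') (β ⋆ β') (by simp [h, h']) ⋆ γ :=
  vcomp_reassoc (hcell_vcomp_hcell α α' β β' h h') γ

end Interchange

section Unitors

variable {x y w z : D} {m : Pro x y} {n : Pro w z} (α : Cell m n)

theorem hcell_hidCell_vcomp_runit {g : y ⟶ z} (h : tgt α = src (hidCell g)) :
    hcell α (hidCell g) h ⋆ cellOf (runit n).hom = cellOf (runit m).hom ⋆ α := by
  obtain rfl : tgt α = g := by simpa using h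
  exact runit_naturality α h

theorem hidCell_hcell_vcomp_lunit {f : x ⟶ w} (h : tgt (hidCell f) = src α) :
    hcell (hidCell f) α h ⋆ cellOf (lunit n).hom = cellOf (lunit m).hom ⋆ α := by
  obtain rfl : f = src α := by simpa using h
  exact lunit_naturality α h

theorem runit_inv_vcomp_hcell_hidCell {g : y ⟶ z} (h : tgt α = src (hidCell g)) :
    cellOf (runit m).inv ⋆ hcell α (hidCell g) h = α ⋆ cellOf (runit n).inv :=
  inv_vcomp_eq_vcomp_inv (hcell_hidCell_vcomp_runit α h)

theorem lunit_inv_vcomp_hidCell_hcell {f : x ⟶ w} (h : tgt (hidCell f) = src α) :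
    cellOf (lunit m).inv ⋆ hcell (hidCell f) α h = α ⋆ cellOf (lunit n).inv :=
  inv_vcomp_eq_vcomp_inv (hidCell_hcell_vcomp_lunit α h)

theorem lunit_hid_eq_runit_hid (x : D) : lunit (hid x) = runit (hid x) :=
  Iso.ext (unitors_equal (B := UBicat D) (a := ⟨x⟩))

end Unitors

theorem runit_hcomp {x y z : D} (m : Pro x y) (n : Pro y z) :
    cellOf (runit (m ⊙ n)).hom = cellOf (assoc' m n (hid z)).hom ⋆ (vid m ◫ cellOf (runit n).hom) :=
  congrArg cellOf (rightUnitor_comp (B := UBicat D) (a := ⟨x⟩) (b := ⟨y⟩) (c := ⟨z⟩) m n)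

theorem runit_inv_hcomp {x y z : D} (m : Pro x y) (n : Pro y z) :
    cellOf (runit (m ⊙ n)).inv =
      (vid m ◫ cellOf (runit n).inv) ⋆ cellOf (assoc' m n (hid z)).inv :=
  congrArg cellOf (rightUnitor_comp_inv (B := UBicat D) (a := ⟨x⟩) (b := ⟨y⟩) (c := ⟨z⟩) m n)

theorem lunit_inv_hcomp {x y z : D} (m : Pro x y) (n : Pro y z) :
    cellOf (lunit (m ⊙ n)).inv =
      (cellOf (lunit m).inv ◫ vid n) ⋆ cellOf (assoc' (hid x) m n).hom :=
  congrArg cellOf (leftUnitor_comp_inv (B := UBicat D) (a := ⟨x⟩) (b := ⟨y⟩) (c := ⟨z⟩) m n)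

theorem runit_inv_hcell_vcomp_assoc {x y z : D} (m : Pro x y) (n : Pro y z) :
    (cellOf (runit m).inv ◫ vid n) ⋆ cellOf (assoc' m (hid y) n).hom =
      vid m ◫ cellOf (lunit n).inv :=
  congrArg cellOf
    (triangle_assoc_comp_right_inv (B := UBicat D) (a := ⟨x⟩) (b := ⟨y⟩) (c := ⟨z⟩) m n)

theorem assoc_inv_vcomp_hcell {x y z w x' y' z' w' : D} {m : Pro x y} {n : Pro y z} {k : Pro z w}
    {m' : Pro x' y'} {n' : Pro y' z'} {k' : Pro z' w'} (α : Cell m m') (β : Cell n n')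
    (γ : Cell k k') (h : tgt α = src β) (h' : tgt β = src γ) :
    cellOf (assoc' m n k).inv ⋆ ((α ◫ β) ◫ γ) = (α ◫ (β ◫ γ)) ⋆ cellOf (assoc' m' n' k').inv :=
  inv_vcomp_eq_vcomp_inv (assoc_naturality α β γ h h' _ _)

end DoubleCategory

namespace Companion

variable {D : Type u} [CellCategory.{c, p, v} D] [DoubleCategory D]

attribute [local simp] hcell_vcomp_hcell hcell_vcomp_hcell_assoc

section Extend

variable {x y z : D} {f : y ⟶ z} (c : Companion f)

/-- The cell from `m` to `m ⊙ f_!` with source `𝟙` and target `f` obtained by pasting `m` with the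
unit of `f_!`. It is opcartesian: see `Companion.hom_ext` for the uniqueness and
`Companion.extend_vcomp_slide` for the existence of factorizations. -/
def extend (m : Pro x y) : Cell m (m ⊙ c.pro) :=
  cellOf (runit m).inv ⋆ (vid m ◫ c.unit)

@[simp] theorem src_extend (m : Pro x y) : src (c.extend m) = 𝟙 x := by simp [extend]

@[simp] theorem tgt_extend (m : Pro x y) : tgt (c.extend m) = f := by simp [extend]

theorem vcomp_extend {w : D} {m : Pro x y} {n : Pro w y} (φ : Cell m n) (h : tgt φ = 𝟙 y) :
    φ ⋆ c.extend n = c.extend m ⋆ (φ ◫ vid c.pro) := by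
  have runit_naturality := runit_inv_vcomp_hcell_hidCell φ (g := 𝟙 y) (by simp [h])
  calc φ ⋆ c.extend n
      = cellOf (runit m).inv ⋆ (φ ◫ hidCell (𝟙 y)) ⋆ (vid n ◫ c.unit) := by
        rw [vcomp_reassoc runit_naturality, vcomp_assoc, extend]
    _ = c.extend m ⋆ (φ ◫ vid c.pro) := by simp [extend]

theorem extend_hcomp {w : D} (m : Pro w x) (n : Pro x y) :
    c.extend (m ⊙ n) ⋆ cellOf (assoc' m n c.pro).hom = vid m ◫ c.extend n := by
  have assoc_naturality := assoc_naturality (vid m) (vid n) c.unit (by simp) (by simp) (by simp)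
    (by simp)
  simp only [hcell_vid] at assoc_naturality
  simp [extend, runit_inv_hcomp, assoc_naturality]

theorem extend_hid : c.extend (hid y) ⋆ cellOf (lunit c.pro).hom = c.unit := by
  have lunit_naturality := hidCell_hcell_vcomp_lunit c.unit (f := 𝟙 y) (by simp)
  simp only [hidCell_id] at lunit_naturality
  simp [extend, lunit_naturality, ← lunit_hid_eq_runit_hid]

theorem extend_hcell_counit (m : Pro x y) :
    (c.extend m ◫ c.counit) ⋆ cellOf (runit (m ⊙ c.pro)).hom = vid (m ⊙ c.pro) := by
  have assoc_naturality := assoc_naturality (vid m) c.unit c.counit (by simp) (by simp) (by simp)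
    (by simp)
  have triangle := runit_inv_hcell_vcomp_assoc m c.pro
  calc (c.extend m ◫ c.counit) ⋆ cellOf (runit (m ⊙ c.pro)).hom
      = (cellOf (runit m).inv ◫ vid c.pro) ⋆ ((vid m ◫ c.unit) ◫ c.counit) ⋆
          cellOf (assoc' m c.pro (hid z)).hom ⋆ (vid m ◫ cellOf (runit c.pro).hom) := by
        simp [extend, runit_hcomp]
    _ = vid m ◫ (cellOf (lunit c.pro).inv ⋆ (c.unit ◫ c.counit) ⋆ cellOf (runit c.pro).hom) := by
        rw [vcomp_reassoc assoc_naturality, vcomp_assoc, vcomp_reassoc triangle]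
        simp
    _ = vid (m ⊙ c.pro) := by simp [c.unit_hcell_counit]

theorem hom_ext {m : Pro x y} {k : Pro x z} {φ ψ : m ⊙ c.pro ⟶ k}
    (h : c.extend m ⋆ cellOf φ = c.extend m ⋆ cellOf ψ) : φ = ψ := by
  suffices retraction : ∀ χ : m ⊙ c.pro ⟶ k,
      cellOf χ = ((c.extend m ⋆ cellOf χ) ◫ c.counit) ⋆ cellOf (runit k).hom by
    ext
    rw [retraction φ, retraction ψ]
    simp only [h]
  intro χ
  have runit_naturality := hcell_hidCell_vcomp_runit (cellOf χ) (g := 𝟙 z) (by simp)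
  symm
  calc ((c.extend m ⋆ cellOf χ) ◫ c.counit) ⋆ cellOf (runit k).hom
      = (c.extend m ◫ c.counit) ⋆ (cellOf χ ◫ hidCell (𝟙 z)) ⋆ cellOf (runit k).hom := by simp
    _ = cellOf χ := by
        rw [runit_naturality, vcomp_reassoc (c.extend_hcell_counit m), vid_vcomp]

end Extend

section Prepend

variable {x y w z : D} {f : x ⟶ w} (c : Companion f) {m : Pro x y} {n : Pro w z}

/-- The cell from `m` to `f_! ⊙ n` obtained from a cell `α : m ⟶ n` with source `f` by pasting the
unit of `f_!` on its left. -/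
def prepend (α : Cell m n) (h : src α = f) : Cell m (c.pro ⊙ n) :=
  cellOf (lunit m).inv ⋆ (c.unit ◫ α)

@[simp] theorem src_prepend (α : Cell m n) (h : src α = f) : src (c.prepend α h) = 𝟙 x := by
  simp [prepend]

@[simp] theorem tgt_prepend (α : Cell m n) (h : src α = f) : tgt (c.prepend α h) = tgt α := by
  simp [prepend]

theorem prepend_vcomp_hcell {a : D} {k : Pro w a} (α : Cell m n) (h : src α = f)
    (φ : Cell n k) (hφ : src φ = 𝟙 w) :
    c.prepend α h ⋆ (vid c.pro ◫ φ) = c.prepend (α ⋆ φ) (by simp [*]) := by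
  simp [prepend]

theorem vcomp_prepend {b : D} {k : Pro x b} (φ : Cell k m) (hφ : src φ = 𝟙 x) (α : Cell m n)
    (h : src α = f) : φ ⋆ c.prepend α h = c.prepend (φ ⋆ α) (by simp [*]) := by
  have lunit_naturality := lunit_inv_vcomp_hidCell_hcell φ (f := 𝟙 x) (by simp [hφ])
  calc φ ⋆ c.prepend α h
      = cellOf (lunit k).inv ⋆ (hidCell (𝟙 x) ◫ φ) ⋆ (c.unit ◫ α) := by
        rw [vcomp_reassoc lunit_naturality, vcomp_assoc, prepend]
    _ = c.prepend (φ ⋆ α) (by simp [*]) := by simp [prepend]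

theorem prepend_hidCell : c.prepend (hidCell f) (by simp) = c.unit ⋆ cellOf (runit c.pro).inv := by
  have runit_naturality := runit_inv_vcomp_hcell_hidCell c.unit (g := f) (by simp)
  rw [prepend, lunit_hid_eq_runit_hid, runit_naturality]

theorem prepend_counit_vcomp_runit :
    c.prepend c.counit (by simp) ⋆ cellOf (runit c.pro).hom = vid c.pro := by
  simp [prepend, c.unit_hcell_counit]

theorem prepend_hcell {a b : D} {m' : Pro y a} {n' : Pro z b} (α : Cell m n) (h : src α = f)
    (β : Cell m' n') (hβ : tgt α = src β) :
    c.prepend (α ◫ β) (by simp [h]) =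
      (c.prepend α h ◫ β) ⋆ cellOf (assoc' c.pro n n').hom := by
  have assoc_naturality := assoc_naturality c.unit α β (by simp [h]) hβ (by simpa) (by simp [h])
  calc c.prepend (α ◫ β) (by simp [h])
      = (cellOf (lunit m).inv ◫ vid m') ⋆ ((c.unit ◫ α) ◫ β) ⋆ cellOf (assoc' c.pro n n').hom := by
        rw [prepend, lunit_inv_hcomp, vcomp_assoc, assoc_naturality]
    _ = (c.prepend α h ◫ β) ⋆ cellOf (assoc' c.pro n n').hom := by simp [prepend]

theorem hcell_prepend {a : D} (l : Pro a x) (α : Cell m n) (h : src α = f) :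
    (vid l ◫ c.prepend α h) ⋆ cellOf (assoc' l c.pro n).inv = c.extend l ◫ α := by
  have assoc_naturality := assoc_inv_vcomp_hcell (vid l) c.unit α (by simp) (by simp [h])
  have triangle := runit_inv_hcell_vcomp_assoc l m
  calc (vid l ◫ c.prepend α h) ⋆ cellOf (assoc' l c.pro n).inv
      = (vid l ◫ cellOf (lunit m).inv) ⋆ (vid l ◫ (c.unit ◫ α)) ⋆
          cellOf (assoc' l c.pro n).inv := by simp [prepend]
    _ = (cellOf (runit l).inv ◫ vid m) ⋆ ((vid l ◫ c.unit) ◫ α) := by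
        rw [← assoc_naturality, ← triangle]
        simp
    _ = c.extend l ◫ α := by simp [extend]

end Prepend

section Slide

variable {x y w z : D} {f : x ⟶ w} {g : y ⟶ z} (cf : Companion f) (cg : Companion g)
  {m : Pro x y} {n : Pro w z}

theorem extend_vcomp_slide (α : Cell m n) (hs : src α = f) (ht : tgt α = g) :
    cg.extend m ⋆ cellOf (slide cf cg α hs ht) = cf.prepend α hs := by
  have runit_naturality := hcell_hidCell_vcomp_runit (cf.prepend α hs) (g := g) (by simp [ht])
  calc cg.extend m ⋆ cellOf (slide cf cg α hs ht)
      = cg.extend m ⋆ (cellOf (lunit m).inv ◫ vid cg.pro) ⋆ ((cf.unit ◫ α) ◫ cg.counit) ⋆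
          cellOf (runit (cf.pro ⊙ n)).hom := rfl
    _ = cellOf (runit m).inv ⋆ (cf.prepend α hs ◫ hidCell g) ⋆
          cellOf (runit (cf.pro ⊙ n)).hom := by simp [extend, prepend, cg.unit_vcomp_counit]
    _ = cf.prepend α hs := by rw [runit_naturality, inv_vcomp_hom_assoc]

theorem eq_slide {α : Cell m n} {hs : src α = f} {ht : tgt α = g}
    {φ : m ⊙ cg.pro ⟶ cf.pro ⊙ n} (h : cg.extend m ⋆ cellOf φ = cf.prepend α hs) :
    φ = slide cf cg α hs ht :=
  cg.hom_ext (h.trans (extend_vcomp_slide cf cg α hs ht).symm)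

end Slide

section Identity

/-- The external identity proarrow, as a companion of the identity arrow. -/
abbrev id (x : D) : Companion (𝟙 x) where
  pro := hid x
  unit := vid (hid x)
  counit := vid (hid x)
  src_unit := by simp
  tgt_unit := by simp
  src_counit := by simp
  tgt_counit := by simp
  unit_hcell_counit _ := by simp [lunit_hid_eq_runit_hid]
  unit_vcomp_counit := by simp

theorem extend_id {x y : D} (m : Pro x y) : (id y).extend m = cellOf (runit m).inv := by
  simp [extend]

theorem prepend_id {x y z : D} {m : Pro x y} {n : Pro x z} (α : Cell m n) (h : src α = 𝟙 x) :
    (id x).prepend α h = α ⋆ cellOf (lunit n).inv := by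
  have lunit_naturality := lunit_inv_vcomp_hidCell_hcell α (f := 𝟙 x) (by simp [h])
  simpa [prepend] using lunit_naturality

end Identity

section Composition

variable {x y z : D} {f : x ⟶ y} {g : y ⟶ z} (cf : Companion f) (cg : Companion g)

/-- The composite of companions, as a companion of the composite arrow. -/
@[simps] abbrev comp : Companion (f ≫ g) where
  pro := cf.pro ⊙ cg.pro
  unit := cf.unit ⋆ cg.extend cf.pro
  counit := (cf.counit ◫ vid cg.pro) ⋆ cellOf (lunit cg.pro).hom ⋆ cg.counit
  src_unit := by simp
  tgt_unit := by simp
  src_counit := by simp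
  tgt_counit := by simp
  unit_hcell_counit _ := by
    have extend_counit := cg.extend_hcell_counit cf.pro
    have prepend_counit : cf.prepend ((cf.counit ◫ vid cg.pro) ⋆ cellOf (lunit cg.pro).hom)
        (by simp) = vid (cf.pro ⊙ cg.pro) := by
      rw [← cf.prepend_vcomp_hcell (cf.counit ◫ vid cg.pro) (by simp) _ (by simp),
        cf.prepend_hcell cf.counit (by simp) (vid cg.pro) (by simp), vcomp_assoc,
        triangle' _ _ (by simp) (by simp)]
      simp [prepend_counit_vcomp_runit]
    calc _ = (cf.unit ◫ ((cf.counit ◫ vid cg.pro) ⋆ cellOf (lunit cg.pro).hom)) ⋆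
          (cg.extend cf.pro ◫ cg.counit) ⋆ cellOf (runit (cf.pro ⊙ cg.pro)).hom := by simp
      _ = cellOf (lunit (cf.pro ⊙ cg.pro)).hom ⋆
          cf.prepend ((cf.counit ◫ vid cg.pro) ⋆ cellOf (lunit cg.pro).hom) (by simp) := by
        rw [extend_counit, vcomp_vid, prepend, hom_vcomp_inv_assoc]
      _ = cellOf (lunit (cf.pro ⊙ cg.pro)).hom := by rw [prepend_counit, vcomp_vid]
  unit_vcomp_counit := by
    have counit_naturality := cg.vcomp_extend cf.counit (by simp)
    rw [vcomp_assoc, vcomp_reassoc counit_naturality.symm, vcomp_assoc, vcomp_reassoc cg.extend_hid,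
      cg.unit_vcomp_counit, vcomp_reassoc cf.unit_vcomp_counit, hidCell_comp]

theorem extend_comp {w : D} (m : Pro w x) :
    (cf.comp cg).extend m ⋆ cellOf (assoc' m cf.pro cg.pro).inv =
      cf.extend m ⋆ cg.extend (m ⊙ cf.pro) := by
  calc (cf.comp cg).extend m ⋆ cellOf (assoc' m cf.pro cg.pro).inv
      = cf.extend m ⋆ (vid m ◫ cg.extend cf.pro) ⋆ cellOf (assoc' m cf.pro cg.pro).inv := by
        simp [extend]
    _ = cf.extend m ⋆ cg.extend (m ⊙ cf.pro) := by rw [← extend_hcomp]; simp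

theorem prepend_comp {w a b : D} {m : Pro x w} {n : Pro y a} {k : Pro z b} (α : Cell m n)
    (hα : src α = f) (β : Cell n k) (hβ : src β = g) :
    (cf.comp cg).prepend (α ⋆ β) (by simp [hα, hβ]) =
      cf.prepend α hα ⋆ (vid cf.pro ◫ cg.prepend β hβ) ⋆ cellOf (assoc' cf.pro cg.pro k).inv := by
  rw [hcell_prepend]
  simp [prepend]

end Composition

section Comparison

variable {x y z : D} {f f' f'' : x ⟶ y}

/-- A globular cell between companions is a comparison if it carries unit to unit. It can exist only
between companions of the same arrow, but the two descriptions `f` and `f'` of that arrow may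
differ, as in `f ≫ 𝟙 y` and `f`. -/
def IsComparison (c : Companion f) (c' : Companion f') (φ : c.pro ⟶ c'.pro) : Prop :=
  c.unit ⋆ cellOf φ = c'.unit

namespace IsComparison

variable {c : Companion f} {c' : Companion f'} {c'' : Companion f''} {φ : c.pro ⟶ c'.pro}

theorem comp {ψ : c'.pro ⟶ c''.pro} (hφ : IsComparison c c' φ) (hψ : IsComparison c' c'' ψ) :
    IsComparison c c'' (φ ≫ ψ) := by
  rw [IsComparison, cellOf_comp, vcomp_reassoc hφ]
  exact hψ

theorem inv {e : c.pro ≅ c'.pro} (h : IsComparison c c' e.hom) : IsComparison c' c e.inv := by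
  rw [IsComparison, ← h]
  simp

theorem eq_id {φ : c.pro ⟶ c.pro} (h : IsComparison c c φ) : φ = 𝟙 c.pro := by
  rw [← cancel_epi (lunit c.pro).hom]
  apply c.hom_ext
  rw [cellOf_comp, cellOf_comp, vcomp_reassoc c.extend_hid, vcomp_reassoc c.extend_hid]
  exact h.trans (vcomp_vid c.unit).symm

theorem extend_vcomp (h : IsComparison c c' φ) {w : D} (m : Pro w x) :
    c.extend m ⋆ cellOf (wl m φ) = c'.extend m := by
  have unit_vcomp : c.unit ⋆ cellOf φ = c'.unit := h
  simp [extend, unit_vcomp]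

theorem prepend_vcomp (h : IsComparison c c' φ) {a b : D} {m : Pro x a} {n : Pro y b}
    (α : Cell m n) (hα : src α = f) (hα' : src α = f') :
    c.prepend α hα ⋆ cellOf (wr φ n) = c'.prepend α hα' := by
  have unit_vcomp : c.unit ⋆ cellOf φ = c'.unit := h
  simp [prepend, unit_vcomp]

theorem whiskerLeft {w : D} {g : w ⟶ x} (b : Companion g) (h : IsComparison c c' φ) :
    IsComparison (b.comp c) (b.comp c') (wl b.pro φ) := by
  rw [IsComparison, comp_unit, vcomp_assoc, h.extend_vcomp]

theorem whiskerRight {g : y ⟶ z} (h : IsComparison c c' φ) (b : Companion g) :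
    IsComparison (c.comp b) (c'.comp b) (wr φ b.pro) := by
  have φ_naturality := b.vcomp_extend (cellOf φ) (by simp)
  simp only [IsComparison, vcomp_assoc, cellOf_hglob, cellOf_id]
  rw [← φ_naturality, vcomp_reassoc h]

theorem assoc {w : D} {g : y ⟶ z} {k : z ⟶ w} (a : Companion f) (b : Companion g)
    (c : Companion k) :
    IsComparison ((a.comp b).comp c) (a.comp (b.comp c)) (assoc' a.pro b.pro c.pro).hom := by
  simp only [IsComparison, vcomp_assoc]
  rw [← vcomp_assoc (b.extend a.pro), ← extend_comp]
  simp

theorem lunit (c : Companion f) : IsComparison ((id x).comp c) c (lunit c.pro).hom := by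
  simpa [IsComparison] using c.extend_hid

theorem runit (c : Companion f) : IsComparison (c.comp (id y)) c (runit c.pro).hom := by
  simp [IsComparison, extend_id]

end IsComparison

/-- A companion of an identity arrow is isomorphic to the external identity proarrow. -/
def isoHid {f : x ⟶ x} (c : Companion f) (hf : f = 𝟙 x) : hid x ≅ c.pro where
  hom := Globular.mk c.unit c.src_unit (c.tgt_unit.trans hf)
  inv := Globular.mk c.counit (c.src_counit.trans hf) c.tgt_counit
  hom_inv_id := glob_ext (by subst hf; simpa using c.unit_vcomp_counit)
  inv_hom_id := by
    subst hf
    have unit_counit_unit : c.unit ⋆ c.counit ⋆ c.unit = c.unit := by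
      rw [vcomp_reassoc c.unit_vcomp_counit]
      simp
    exact IsComparison.eq_id unit_counit_unit

theorem isComparison_isoHid_hom {f : x ⟶ x} (c : Companion f) (hf : f = 𝟙 x) :
    IsComparison (id x) c (c.isoHid hf).hom :=
  vid_vcomp c.unit

end Comparison

section SlideCalculus

variable {x y w z : D} {f : x ⟶ w} {g : y ⟶ z} {cf : Companion f} {cg : Companion g}
  {m : Pro x y} {n : Pro w z}

theorem wr_slide_eq_slide_wl {m' : Pro x y} {n' : Pro w z} {φ : m ⟶ m'} {ψ : n ⟶ n'}
    {α : Cell m n} {β : Cell m' n'} (hαs : src α = f) (hαt : tgt α = g) (hβs : src β = f)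
    (hβt : tgt β = g) (h : cellOf φ ⋆ β = α ⋆ cellOf ψ) :
    wr φ cg.pro ≫ slide cf cg β hβs hβt = slide cf cg α hαs hαt ≫ wl cf.pro ψ := by
  have φ_naturality := cg.vcomp_extend (cellOf φ) (by simp)
  apply cg.hom_ext
  calc cg.extend m ⋆ (cellOf φ ◫ vid cg.pro) ⋆ cellOf (slide cf cg β hβs hβt)
      = cellOf φ ⋆ cf.prepend β hβs := by
        rw [vcomp_reassoc φ_naturality.symm, vcomp_assoc, extend_vcomp_slide]
    _ = cf.prepend α hαs ⋆ (vid cf.pro ◫ cellOf ψ) := by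
        rw [cf.vcomp_prepend (cellOf φ) (by simp), cf.prepend_vcomp_hcell α hαs _ (by simp)]
        simp only [h]
    _ = cg.extend m ⋆ cellOf (slide cf cg α hαs hαt ≫ wl cf.pro ψ) := by
        rw [cellOf_comp, vcomp_reassoc (extend_vcomp_slide cf cg α hαs hαt)]
        rfl

theorem slide_hidCell (cf : Companion f) :
    slide cf cf (hidCell f) (by simp) (by simp) = (lunit cf.pro).hom ≫ (runit cf.pro).inv := by
  refine (eq_slide cf cf ?_).symm
  rw [cellOf_comp, vcomp_reassoc cf.extend_hid, prepend_hidCell]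

theorem slide_hcell {a b : D} {h : a ⟶ b} {ch : Companion h} {m' : Pro y a} {n' : Pro z b}
    {α : Cell m n} {β : Cell m' n'} (hαs : src α = f) (hαt : tgt α = g) (hβs : src β = g)
    (hβt : tgt β = h) :
    slide cf ch (α ◫ β) (by simp [hαs]) (by simp [hβt]) =
      (assoc' m m' ch.pro).hom ≫ wl m (slide cg ch β hβs hβt) ≫ (assoc' m cg.pro n').inv ≫
        wr (slide cf cg α hαs hαt) n' ≫ (assoc' cf.pro n n').hom := by
  refine (eq_slide cf ch ?_).symm
  have extend_vcomp : ch.extend (m ⊙ m') ⋆ cellOf (assoc' m m' ch.pro).hom ⋆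
      (vid m ◫ cellOf (slide cg ch β hβs hβt)) = vid m ◫ cg.prepend β hβs := by
    rw [vcomp_reassoc (ch.extend_hcomp m m')]
    simp [extend_vcomp_slide]
  calc ch.extend (m ⊙ m') ⋆ cellOf ((assoc' m m' ch.pro).hom ≫ wl m (slide cg ch β hβs hβt) ≫
        (assoc' m cg.pro n').inv ≫ wr (slide cf cg α hαs hαt) n' ≫ (assoc' cf.pro n n').hom)
      = (vid m ◫ cg.prepend β hβs) ⋆ cellOf (assoc' m cg.pro n').inv ⋆
          (cellOf (slide cf cg α hαs hαt) ◫ vid n') ⋆ cellOf (assoc' cf.pro n n').hom := by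
        rw [← extend_vcomp]
        simp
    _ = (cf.prepend α hαs ◫ β) ⋆ cellOf (assoc' cf.pro n n').hom := by
        rw [vcomp_reassoc (cg.hcell_prepend m β hβs)]
        simp [extend_vcomp_slide]
    _ = cf.prepend (α ◫ β) (by simp [hαs]) := by
        rw [cf.prepend_hcell α hαs β (by simp [*])]

theorem slide_vcomp {a b : D} {h : w ⟶ a} {k : z ⟶ b} (ch : Companion h) (ck : Companion k)
    {l : Pro a b} {α : Cell m n} {β : Cell n l} (hαs : src α = f) (hαt : tgt α = g)
    (hβs : src β = h) (hβt : tgt β = k) :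
    slide (cf.comp ch) (cg.comp ck) (α ⋆ β) (by simp [hαs, hβs]) (by simp [hαt, hβt]) =
      (assoc' m cg.pro ck.pro).inv ≫ wr (slide cf cg α hαs hαt) ck.pro ≫
        (assoc' cf.pro n ck.pro).hom ≫ wl cf.pro (slide ch ck β hβs hβt) ≫
          (assoc' cf.pro ch.pro l).inv := by
  refine (eq_slide (cf.comp ch) (cg.comp ck) ?_).symm
  have slide_naturality := ck.vcomp_extend (cellOf (slide cf cg α hαs hαt)) (by simp)
  calc (cg.comp ck).extend m ⋆ cellOf ((assoc' m cg.pro ck.pro).inv ≫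
        wr (slide cf cg α hαs hαt) ck.pro ≫ (assoc' cf.pro n ck.pro).hom ≫
          wl cf.pro (slide ch ck β hβs hβt) ≫ (assoc' cf.pro ch.pro l).inv)
      = cg.extend m ⋆ ck.extend (m ⊙ cg.pro) ⋆ (cellOf (slide cf cg α hαs hαt) ◫ vid ck.pro) ⋆
          cellOf (assoc' cf.pro n ck.pro).hom ⋆ (vid cf.pro ◫ cellOf (slide ch ck β hβs hβt)) ⋆
            cellOf (assoc' cf.pro ch.pro l).inv := by
        rw [cellOf_comp, vcomp_reassoc (extend_comp cg ck m)]
        simp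
    _ = cf.prepend α hαs ⋆ (vid cf.pro ◫ ck.extend n) ⋆
          (vid cf.pro ◫ cellOf (slide ch ck β hβs hβt)) ⋆
            cellOf (assoc' cf.pro ch.pro l).inv := by
        rw [vcomp_reassoc slide_naturality.symm, vcomp_assoc,
          vcomp_reassoc (extend_vcomp_slide cf cg α hαs hαt), vcomp_reassoc (ck.extend_hcomp _ _)]
    _ = (cf.comp ch).prepend (α ⋆ β) (by simp [hαs, hβs]) := by
        rw [prepend_comp cf ch α hαs β hβs]
        simp [extend_vcomp_slide]

theorem IsComparison.wl_slide {f' : x ⟶ w} {g' : y ⟶ z} {cf' : Companion f'} {cg' : Companion g'}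
    {φ : cf.pro ⟶ cf'.pro} {ψ : cg.pro ⟶ cg'.pro} (hφ : IsComparison cf cf' φ)
    (hψ : IsComparison cg cg' ψ) {α : Cell m n} (hs : src α = f) (ht : tgt α = g)
    (hs' : src α = f') (ht' : tgt α = g') :
    wl m ψ ≫ slide cf' cg' α hs' ht' = slide cf cg α hs ht ≫ wr φ n := by
  apply cg.hom_ext
  rw [cellOf_comp, cellOf_comp, vcomp_reassoc (hψ.extend_vcomp m), extend_vcomp_slide,
    vcomp_reassoc (extend_vcomp_slide cf cg α hs ht), hφ.prepend_vcomp]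

theorem slide_vid {f : x ⟶ x} {g : y ⟶ y} (cf : Companion f) (cg : Companion g) (hf : 𝟙 x = f)
    (hg : 𝟙 y = g) {m : Pro x y} {α : Cell m m} (hα : α = vid m) :
    wl m (cg.isoHid hg.symm).hom ≫ slide cf cg α (by simp [hf, hα]) (by simp [hg, hα]) =
      ((runit m).hom ≫ (lunit m).inv) ≫ wr (cf.isoHid hf.symm).hom m := by
  subst hα
  have slide_id : slide (id x) (id y) (vid m) (by simp) (by simp) =
      (runit m).hom ≫ (lunit m).inv := by
    refine (eq_slide (id x) (id y) ?_).symm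
    simp [extend_id, prepend_id]
  rw [← slide_id]
  exact (cf.isComparison_isoHid_hom hf.symm).wl_slide (cg.isComparison_isoHid_hom hg.symm) _ _ _ _

theorem isComparison_slide {p : x ⟶ y} {p' : w ⟶ z} (b : Companion p) (b' : Companion p')
    {α : Cell b.pro b'.pro} (hs : src α = f) (ht : tgt α = g)
    (h : b.unit ⋆ α = hidCell f ⋆ b'.unit) :
    IsComparison (b.comp cg) (cf.comp b') (slide cf cg α hs ht) := by
  calc (b.comp cg).unit ⋆ cellOf (slide cf cg α hs ht)
      = b.unit ⋆ cf.prepend α hs := by rw [comp_unit, vcomp_assoc, extend_vcomp_slide]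
    _ = cf.prepend (hidCell f ⋆ b'.unit) (by simp) := by
        rw [cf.vcomp_prepend b.unit (by simp)]
        simp only [h]
    _ = (cf.comp b').unit := by
        rw [← cf.prepend_vcomp_hcell _ (by simp) _ (by simp), prepend_hidCell, vcomp_assoc]
        rfl

end SlideCalculus

end Companion

namespace DoubleFunctor

variable {D : Type u₁} [CellCategory.{c₁, p₁, v₁} D] [DoubleCategory D]
  {E : Type u₂} [CellCategory.{c₂, p₂, v₂} E] [DoubleCategory E] (F : DoubleFunctor D E)

theorem mapCell_runit_inv {x y : D} (m : Pro x y) :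
    F.mapCell (cellOf (runit m).inv) =
      cellOf (runit (F.mapPro m)).inv ⋆ (vid (F.mapPro m) ◫ cellOf (F.mapId y).hom) ⋆
        cellOf (F.mapComp m (hid y)).hom := by
  have map_runit := F.map_runit m (by simp)
  calc F.mapCell (cellOf (runit m).inv)
      = cellOf (runit (F.mapPro m)).inv ⋆ cellOf (runit (F.mapPro m)).hom ⋆
          F.mapCell (cellOf (runit m).inv) := by simp
    _ = _ := by
        rw [← map_runit, vcomp_assoc, vcomp_assoc, ← mapCell_vcomp]
        simp

theorem mapCell_lunit_inv {x y : D} (m : Pro x y) :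
    F.mapCell (cellOf (lunit m).inv) =
      cellOf (lunit (F.mapPro m)).inv ⋆ (cellOf (F.mapId x).hom ◫ vid (F.mapPro m)) ⋆
        cellOf (F.mapComp (hid x) m).hom := by
  have map_lunit := F.map_lunit m (by simp)
  calc F.mapCell (cellOf (lunit m).inv)
      = cellOf (lunit (F.mapPro m)).inv ⋆ cellOf (lunit (F.mapPro m)).hom ⋆
          F.mapCell (cellOf (lunit m).inv) := by simp
    _ = _ := by
        rw [← map_lunit, vcomp_assoc, vcomp_assoc, ← mapCell_vcomp]
        simp

end DoubleFunctor

namespace Companion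

variable {D : Type u₁} [CellCategory.{c₁, p₁, v₁} D] [DoubleCategory D]
  {E : Type u₂} [CellCategory.{c₂, p₂, v₂} E] [DoubleCategory E]

attribute [local simp] hcell_vcomp_hcell hcell_vcomp_hcell_assoc

section Map

variable (F : DoubleFunctor D E) {x y : D} {f : x ⟶ y} (c : Companion f)

/-- The image of a companion under a double functor, as a companion of the image of the arrow. -/
abbrev map : Companion (F.map f) where
  pro := F.mapPro c.pro
  unit := cellOf (F.mapId x).hom ⋆ F.mapCell c.unit
  counit := F.mapCell c.counit ⋆ cellOf (F.mapId y).inv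
  src_unit := by simp
  tgt_unit := by simp
  src_counit := by simp
  tgt_counit := by simp
  unit_hcell_counit _ := by
    have mapComp_naturality := F.mapComp_naturality c.unit c.counit (by simp) (by simp)
    have mapCell_runit : (vid (F.mapPro c.pro) ◫ cellOf (F.mapId y).inv) ⋆
        cellOf (runit (F.mapPro c.pro)).hom =
          cellOf (F.mapComp c.pro (hid y)).hom ⋆ F.mapCell (cellOf (runit c.pro).hom) := by
      rw [← F.map_runit c.pro (by simp)]
      simp
    calc _ = (cellOf (F.mapId x).hom ◫ vid (F.mapPro c.pro)) ⋆
          (F.mapCell c.unit ◫ F.mapCell c.counit) ⋆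
            (vid (F.mapPro c.pro) ◫ cellOf (F.mapId y).inv) ⋆
              cellOf (runit (F.mapPro c.pro)).hom := by simp
      _ = (cellOf (F.mapId x).hom ◫ vid (F.mapPro c.pro)) ⋆
          cellOf (F.mapComp (hid x) c.pro).hom ⋆
            F.mapCell ((c.unit ◫ c.counit) ⋆ cellOf (runit c.pro).hom) := by
        rw [mapCell_runit, vcomp_reassoc mapComp_naturality, F.mapCell_vcomp, vcomp_assoc]
      _ = cellOf (lunit (F.mapPro c.pro)).hom := by
        rw [c.unit_hcell_counit, F.map_lunit]
  unit_vcomp_counit := by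
    rw [vcomp_assoc, ← vcomp_assoc (F.mapCell _), ← F.mapCell_vcomp, c.unit_vcomp_counit,
      vcomp_reassoc (F.mapId_naturality f).symm, vcomp_assoc, hom_vcomp_inv, vcomp_vid]

theorem map_extend {w : D} (m : Pro w x) :
    (c.map F).extend (F.mapPro m) ⋆ cellOf (F.mapComp m c.pro).hom = F.mapCell (c.extend m) := by
  have mapComp_naturality := F.mapComp_naturality (vid m) c.unit (by simp) (by simp)
  symm
  calc F.mapCell (c.extend m)
      = cellOf (runit (F.mapPro m)).inv ⋆ (vid (F.mapPro m) ◫ cellOf (F.mapId x).hom) ⋆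
          (vid (F.mapPro m) ◫ F.mapCell c.unit) ⋆ cellOf (F.mapComp m c.pro).hom := by
        rw [extend, F.mapCell_vcomp, F.mapCell_runit_inv, vcomp_assoc, vcomp_assoc,
          ← mapComp_naturality]
        simp
    _ = (c.map F).extend (F.mapPro m) ⋆ cellOf (F.mapComp m c.pro).hom := by simp [extend]

theorem map_prepend {w z : D} {m : Pro x w} {n : Pro y z} (α : Cell m n) (h : src α = f) :
    (c.map F).prepend (F.mapCell α) (by simp [h]) ⋆ cellOf (F.mapComp c.pro n).hom =
      F.mapCell (c.prepend α h) := by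
  have mapComp_naturality := F.mapComp_naturality c.unit α (by simp [h]) (by simp [h])
  symm
  calc F.mapCell (c.prepend α h)
      = cellOf (lunit (F.mapPro m)).inv ⋆ (cellOf (F.mapId x).hom ◫ vid (F.mapPro m)) ⋆
          (F.mapCell c.unit ◫ F.mapCell α) ⋆ cellOf (F.mapComp c.pro n).hom := by
        rw [prepend, F.mapCell_vcomp, F.mapCell_lunit_inv, vcomp_assoc, vcomp_assoc,
          mapComp_naturality]
    _ = (c.map F).prepend (F.mapCell α) (by simp [h]) ⋆ cellOf (F.mapComp c.pro n).hom := by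
        simp [prepend]

theorem slide_map {w z : D} {g : w ⟶ z} (cg : Companion g) {m : Pro x w} {n : Pro y z}
    (α : Cell m n) (hs : src α = f) (ht : tgt α = g) :
    slide (c.map F) (cg.map F) (F.mapCell α) (by simp [hs]) (by simp [ht]) =
      (F.mapComp m cg.pro).hom ≫ F.mapGlob (slide c cg α hs ht) ≫ (F.mapComp c.pro n).inv := by
  refine (eq_slide (c.map F) (cg.map F) ?_).symm
  rw [cellOf_comp, vcomp_reassoc (cg.map_extend F m), cellOf_comp, F.cellOf_mapGlob,
    ← vcomp_assoc, ← F.mapCell_vcomp, extend_vcomp_slide, ← map_prepend]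
  simp

section Composite

variable {w z : D} {g : w ⟶ z} (cg : Companion g) {m : Pro x w} {n : Pro y z} {a b : E}

theorem slide_mapCell_vcomp {h : F.obj y ⟶ a} {k : F.obj z ⟶ b} (ch : Companion h)
    (ck : Companion k) {l : Pro a b} {α : Cell m n} {β : Cell (F.mapPro n) l} (hαs : src α = f)
    (hαt : tgt α = g) (hβs : src β = h) (hβt : tgt β = k) :
    slide ((c.map F).comp ch) ((cg.map F).comp ck) (F.mapCell α ⋆ β) (by simp [hαs, hβs])
        (by simp [hαt, hβt]) =
      (assoc' _ _ _).inv ≫ wr ((F.mapComp m cg.pro).hom ≫ F.mapGlob (slide c cg α hαs hαt) ≫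
        (F.mapComp c.pro n).inv) ck.pro ≫ (assoc' _ _ _).hom ≫
          wl (F.mapPro c.pro) (slide ch ck β hβs hβt) ≫ (assoc' _ _ _).inv := by
  rw [← slide_map]
  exact slide_vcomp ch ck _ _ hβs hβt

theorem slide_vcomp_mapCell {h : a ⟶ F.obj x} {k : b ⟶ F.obj w} (ch : Companion h)
    (ck : Companion k) {l : Pro a b} {β : Cell l (F.mapPro m)} {α : Cell m n} (hβs : src β = h)
    (hβt : tgt β = k) (hαs : src α = f) (hαt : tgt α = g) :
    slide (ch.comp (c.map F)) (ck.comp (cg.map F)) (β ⋆ F.mapCell α) (by simp [hαs, hβs])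
        (by simp [hαt, hβt]) =
      (assoc' _ _ _).inv ≫ wr (slide ch ck β hβs hβt) (F.mapPro cg.pro) ≫ (assoc' _ _ _).hom ≫
        wl ch.pro ((F.mapComp m cg.pro).hom ≫ F.mapGlob (slide c cg α hαs hαt) ≫
          (F.mapComp c.pro n).inv) ≫ (assoc' _ _ _).inv := by
  rw [← slide_map]
  exact slide_vcomp _ _ hβs hβt _ _

end Composite

variable {F} {c}

theorem IsComparison.map {f' : x ⟶ y} {c' : Companion f'} {φ : c.pro ⟶ c'.pro}
    (h : IsComparison c c' φ) : IsComparison (c.map F) (c'.map F) (F.mapGlob φ) := by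
  have unit_vcomp : c.unit ⋆ cellOf φ = c'.unit := h
  simp [IsComparison, ← F.mapCell_vcomp, unit_vcomp]

variable (F) (c)

theorem isComparison_mapComp_hom {z : D} {g : y ⟶ z} (cg : Companion g) :
    IsComparison ((c.map F).comp (cg.map F)) ((c.comp cg).map F) (F.mapComp c.pro cg.pro).hom := by
  simp [IsComparison, map_extend]

theorem isComparison_mapId_hom (x : D) :
    IsComparison (id (F.obj x)) ((id x).map F) (F.mapId x).hom := by
  simp [IsComparison]

theorem map_id_unit : (c.map (DoubleFunctor.id D)).unit = c.unit :=
  vid_vcomp c.unit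

theorem map_comp_unit {E' : Type u₃} [CellCategory.{c₃, p₃, v₃} E'] [DoubleCategory E']
    (G : DoubleFunctor E E') : (c.map (F.comp G)).unit = ((c.map F).map G).unit := by
  change cellOf ((G.mapId (F.obj x)).hom ≫ G.mapGlob (F.mapId x).hom) ⋆
    G.mapCell (F.mapCell c.unit) = _
  simp

end Map

end Companion

namespace DoubleNatTrans

variable {D : Type u₁} [CellCategory.{c₁, p₁, v₁} D] [DoubleCategory D]
  {E : Type u₂} [CellCategory.{c₂, p₂, v₂} E] [DoubleCategory E] {F G : DoubleFunctor D E}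
  (α : DoubleNatTrans F G) (comp : ∀ x, Companion (α.app x))

/-- The comparison cell `(α_m)_!` at the proarrow `m` of the oplax transformation whose components
are the chosen companions of the components of `α`. -/
abbrev slideApp {x y : D} (m : Pro x y) :
    F.mapPro m ⊙ (comp y).pro ⟶ (comp x).pro ⊙ G.mapPro m :=
  slide (comp x) (comp y) (α.appPro m) (α.src_appPro m) (α.tgt_appPro m)

theorem slideApp_naturality {x y : D} {m n : Pro x y} (β : m ⟶ n) :
    wr (F.mapGlob β) (comp y).pro ≫ α.slideApp comp n =
      α.slideApp comp m ≫ wl (comp x).pro (G.mapGlob β) :=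
  Companion.wr_slide_eq_slide_wl _ _ _ _ (α.cell_naturality (cellOf β))

theorem slideApp_id (x : D) :
    α.slideApp comp (hid x) ≫ wl (comp x).pro (G.mapId x).inv =
      wr (F.mapId x).inv (comp x).pro ≫ (lunit (comp x).pro).hom ≫ (runit (comp x).pro).inv := by
  rw [← Companion.slide_hidCell]
  exact (Companion.wr_slide_eq_slide_wl _ _ _ _
    (inv_vcomp_eq_vcomp_inv (α.appPro_hid x).symm)).symm

theorem slideApp_comp {x y z : D} (m : Pro x y) (n : Pro y z) :
    α.slideApp comp (m ⊙ n) ≫ wl (comp x).pro (G.mapComp m n).inv =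
      wr (F.mapComp m n).inv (comp z).pro ≫ (assoc' _ _ _).hom ≫
        wl (F.mapPro m) (α.slideApp comp n) ≫ (assoc' _ _ _).inv ≫
        wr (α.slideApp comp m) (G.mapPro n) ≫ (assoc' _ _ _).hom := by
  rw [← Companion.slide_hcell]
  exact (Companion.wr_slide_eq_slide_wl _ _ _ _
    (inv_vcomp_eq_vcomp_inv (α.appPro_hcomp m n (by simp)).symm)).symm

theorem map_unit_vcomp_appPro {x y : D} {f : x ⟶ y} (c : Companion f) :
    (c.map F).unit ⋆ α.appPro c.pro = hidCell (α.app x) ⋆ (c.map G).unit := by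
  have cell_naturality := α.cell_naturality c.unit
  simp only [vcomp_assoc, cell_naturality]
  rw [vcomp_reassoc (α.appPro_hid x), vcomp_assoc]

/-- The oplax natural transformation `α_!` with components the chosen companions of the components
of `α` and comparisons the cells `(α_m)_!`. -/
def toOplaxTrans : LaxAdj.Opl F.toPseudofunctor G.toPseudofunctor where
  app x := (comp x.as).pro
  naturality m := α.slideApp comp m
  naturality_naturality β := α.slideApp_naturality comp β
  naturality_id x := α.slideApp_id comp x.as
  naturality_comp m n := α.slideApp_comp comp m n

theorem isTranspose_slideApp :
    α.IsTranspose comp (fun x => (comp x).pro) (fun m => α.slideApp comp m) :=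
  ⟨fun _ => rfl, fun m => by simp⟩

end DoubleNatTrans

namespace DoubleAdjunction

open Companion

variable {D : Type u₁} [CellCategory.{c₁, p₁, v₁} D] [DoubleCategory D]
  {E : Type u₂} [CellCategory.{c₂, p₂, v₂} E] [DoubleCategory E]
  {F : DoubleFunctor D E} {G : DoubleFunctor E D} (adj : DoubleAdjunction F G)
  (unitComp : ∀ x : D, Companion (adj.unit.app x))
  (counitComp : ∀ y : E, Companion (adj.counit.app y))

/-- The oplax transformation `η_! : 1 ⟶ G F`. Its type differs from that of `toOplaxTrans` in that
identities and composites are formed with pseudofunctors rather than with double functors. -/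
def unitOplax : LaxAdj.Opl (Pseudofunctor.id (UBicat D))
    (F.toPseudofunctor.comp G.toPseudofunctor) :=
  adj.unit.toOplaxTrans unitComp

/-- The oplax transformation `ε_! : F G ⟶ 1`, typed as in `unitOplax`. -/
def counitOplax : LaxAdj.Opl (G.toPseudofunctor.comp F.toPseudofunctor)
    (Pseudofunctor.id (UBicat E)) :=
  adj.counit.toOplaxTrans counitComp

/-- The companion `F(η_x)_! ⊙ (ε_{F x})_!` of the first composite in the triangle identities. -/
abbrev leftCompanion (x : D) : Companion (F.map (adj.unit.app x) ≫ adj.counit.app (F.obj x)) :=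
  ((unitComp x).map F).comp (counitComp (F.obj x))

/-- The companion `(η_{G y})_! ⊙ G(ε_y)_!` of the second composite in the triangle identities. -/
abbrev rightCompanion (y : E) : Companion (adj.unit.app (G.obj y) ≫ G.map (adj.counit.app y)) :=
  (unitComp (G.obj y)).comp ((counitComp y).map G)

/-- The component `s_x` of the first triangulator. -/
abbrev leftTriangulator (x : D) : hid (F.obj x) ≅ (adj.leftCompanion unitComp counitComp x).pro :=
  (adj.leftCompanion unitComp counitComp x).isoHid (adj.left_triangle x)

/-- The inverse `t_y⁻¹` of the component of the second triangulator. -/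
abbrev rightTriangulator (y : E) : hid (G.obj y) ≅ (adj.rightCompanion unitComp counitComp y).pro :=
  (adj.rightCompanion unitComp counitComp y).isoHid (adj.right_triangle y)

theorem leftTriangulator_naturality {x y : D} (m : Pro x y) :
    wl (F.mapPro m) (adj.leftTriangulator unitComp counitComp y).hom ≫
      (assoc' _ _ _).inv ≫ wr ((F.mapComp _ _).hom ≫ F.mapGlob (adj.unit.slideApp unitComp m) ≫
        (F.mapComp _ _).inv) _ ≫ (assoc' _ _ _).hom ≫
        wl _ (adj.counit.slideApp counitComp (F.mapPro m)) ≫ (assoc' _ _ _).inv =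
    ((runit (F.mapPro m)).hom ≫ (lunit (F.mapPro m)).inv) ≫
      wr (adj.leftTriangulator unitComp counitComp x).hom (F.mapPro m) := by
  have slide_composite := slide_mapCell_vcomp F (unitComp x) (unitComp y) (counitComp (F.obj x))
    (counitComp (F.obj y)) (adj.unit.src_appPro m) (adj.unit.tgt_appPro m)
    (adj.counit.src_appPro (F.mapPro m)) (adj.counit.tgt_appPro (F.mapPro m))
  have slide_identity := slide_vid (adj.leftCompanion unitComp counitComp x)
    (adj.leftCompanion unitComp counitComp y) (adj.left_triangle x).symm
    (adj.left_triangle y).symm (adj.left_triangle_pro m)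
  exact (congrArg _ slide_composite.symm).trans slide_identity

theorem rightTriangulator_naturality {x y : E} (n : Pro x y) :
    wl (G.mapPro n) (adj.rightTriangulator unitComp counitComp y).hom ≫
      (assoc' _ _ _).inv ≫ wr (adj.unit.slideApp unitComp (G.mapPro n)) _ ≫ (assoc' _ _ _).hom ≫
        wl _ ((G.mapComp _ _).hom ≫ G.mapGlob (adj.counit.slideApp counitComp n) ≫
          (G.mapComp _ _).inv) ≫ (assoc' _ _ _).inv =
    ((runit (G.mapPro n)).hom ≫ (lunit (G.mapPro n)).inv) ≫
      wr (adj.rightTriangulator unitComp counitComp x).hom (G.mapPro n) := by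
  have slide_composite := slide_vcomp_mapCell G (counitComp x) (counitComp y)
    (unitComp (G.obj x)) (unitComp (G.obj y)) (adj.unit.src_appPro (G.mapPro n))
    (adj.unit.tgt_appPro (G.mapPro n)) (adj.counit.src_appPro n) (adj.counit.tgt_appPro n)
  have slide_identity := slide_vid (adj.rightCompanion unitComp counitComp x)
    (adj.rightCompanion unitComp counitComp y) (adj.right_triangle x).symm
    (adj.right_triangle y).symm (adj.right_triangle_pro n)
  exact (congrArg _ slide_composite.symm).trans slide_identity

theorem isComparison_slideApp_unit {x y : D} {f : x ⟶ y} (c : Companion f) :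
    IsComparison (c.comp (unitComp y)) ((unitComp x).comp ((c.map F).map G))
      (adj.unit.slideApp unitComp c.pro) := by
  apply isComparison_slide c ((c.map F).map G)
  rw [← map_comp_unit, ← map_id_unit c]
  exact adj.unit.map_unit_vcomp_appPro c

theorem isComparison_slideApp_counit {x y : E} {f : x ⟶ y} (c : Companion f) :
    IsComparison (((c.map G).map F).comp (counitComp y)) ((counitComp x).comp c)
      (adj.counit.slideApp counitComp c.pro) := by
  apply isComparison_slide ((c.map G).map F) c
  rw [← map_comp_unit, ← map_id_unit c]
  exact adj.counit.map_unit_vcomp_appPro c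

theorem swallowtail_unit (x : D) :
    (runit (unitComp x).pro).inv ≫
      wl (unitComp x).pro (adj.rightTriangulator unitComp counitComp (F.obj x)).hom ≫
      (assoc' _ _ _).inv ≫
      wr (adj.unit.slideApp unitComp (unitComp x).pro) (G.mapPro (counitComp (F.obj x)).pro) ≫
      (assoc' _ _ _).hom ≫
      wl (unitComp x).pro ((G.mapComp (F.mapPro (unitComp x).pro) (counitComp (F.obj x)).pro).hom ≫
        G.mapGlob (adj.leftTriangulator unitComp counitComp x).inv ≫ (G.mapId (F.obj x)).inv) ≫
      (runit (unitComp x).pro).hom = 𝟙 (unitComp x).pro := by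
  let b := unitComp x
  let c := counitComp (F.obj x)
  have isComparison_left_inv := (isComparison_mapComp_hom G (b.map F) c).comp
    (((isComparison_isoHid_hom _ (adj.left_triangle x)).inv.map (F := G)).comp
      (isComparison_mapId_hom G (F.obj x)).inv)
  apply IsComparison.eq_id
  exact (IsComparison.runit b).inv.comp <|
    ((isComparison_isoHid_hom _ (adj.right_triangle (F.obj x))).whiskerLeft b).comp <|
    (IsComparison.assoc b (unitComp (G.obj (F.obj x))) (c.map G)).inv.comp <|
    ((adj.isComparison_slideApp_unit unitComp b).whiskerRight (c.map G)).comp <|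
    (IsComparison.assoc b ((b.map F).map G) (c.map G)).comp <|
    (isComparison_left_inv.whiskerLeft b).comp (IsComparison.runit b)

theorem swallowtail_counit (y : E) :
    (lunit (counitComp y).pro).inv ≫
      wr ((F.mapId (G.obj y)).hom ≫
        F.mapGlob (adj.rightTriangulator unitComp counitComp y).hom ≫
        (F.mapComp (unitComp (G.obj y)).pro (G.mapPro (counitComp y).pro)).inv)
        (counitComp y).pro ≫
      (assoc' _ _ _).hom ≫
      wl (F.mapPro (unitComp (G.obj y)).pro)
        (adj.counit.slideApp counitComp (counitComp y).pro) ≫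
      (assoc' _ _ _).inv ≫
      wr (adj.leftTriangulator unitComp counitComp (G.obj y)).inv (counitComp y).pro ≫
      (lunit (counitComp y).pro).hom = 𝟙 (counitComp y).pro := by
  let b := unitComp (G.obj y)
  let c := counitComp y
  have isComparison_right := (isComparison_mapId_hom F (G.obj y)).comp
    (((isComparison_isoHid_hom _ (adj.right_triangle y)).map (F := F)).comp
      (isComparison_mapComp_hom F b (c.map G)).inv)
  apply IsComparison.eq_id
  exact (IsComparison.lunit c).inv.comp <|
    (isComparison_right.whiskerRight c).comp <|
    (IsComparison.assoc (b.map F) ((c.map G).map F) c).comp <|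
    ((adj.isComparison_slideApp_counit counitComp c).whiskerLeft (b.map F)).comp <|
    (IsComparison.assoc (b.map F) (counitComp (F.obj (G.obj y))) c).inv.comp <|
    ((isComparison_isoHid_hom _ (adj.left_triangle (G.obj y))).inv.whiskerRight c).comp <|
    IsComparison.lunit c

section

open scoped Oplax.OplaxTrans

/-- The first triangulator `s : 1_F ≅ (F * η_!) ⊙ (ε_! * F)`. -/
def leftModification : 𝟙 F.toPseudofunctor.toOplax ≅
    LaxAdj.leftZigzag (adj.unitOplax unitComp) (adj.counitOplax counitComp) :=
  Oplax.OplaxTrans.isoMk (η := 𝟙 F.toPseudofunctor.toOplax)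
    (θ := LaxAdj.leftZigzag (adj.unitOplax unitComp) (adj.counitOplax counitComp))
    (fun x => adj.leftTriangulator unitComp counitComp x.as)
    (fun m => adj.leftTriangulator_naturality unitComp counitComp m)

/-- The inverse `t⁻¹ : 1_G ≅ (η_! * G) ⊙ (G * ε_!)` of the second triangulator. -/
def rightModification : 𝟙 G.toPseudofunctor.toOplax ≅
    LaxAdj.rightZigzag (adj.unitOplax unitComp) (adj.counitOplax counitComp) :=
  Oplax.OplaxTrans.isoMk (η := 𝟙 G.toPseudofunctor.toOplax)
    (θ := LaxAdj.rightZigzag (adj.unitOplax unitComp) (adj.counitOplax counitComp))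
    (fun y => adj.rightTriangulator unitComp counitComp y.as)
    (fun n => adj.rightTriangulator_naturality unitComp counitComp n)

/-- The lax adjunction `(η_!, ε_!, s, t)` between underlying bicategories. -/
def laxAdjunction : LaxAdjunction F.toPseudofunctor G.toPseudofunctor where
  unit := adj.unitOplax unitComp
  counit := adj.counitOplax counitComp
  s := adj.leftModification unitComp counitComp
  t := (adj.rightModification unitComp counitComp).symm
  swallowtail_unit x := adj.swallowtail_unit unitComp counitComp x.as
  swallowtail_counit y := adj.swallowtail_counit unitComp counitComp y.as

end

end DoubleAdjunction

theorem mainTheorem9 {D : Type u₁} [CellCategory.{c₁, p₁, v₁} D] [DoubleCategory D]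
    {E : Type u₂} [CellCategory.{c₂, p₂, v₂} E] [DoubleCategory E]
    (F : DoubleFunctor D E) (G : DoubleFunctor E D) (adj : DoubleAdjunction F G)
    (unitComp : ∀ x : D, Companion (adj.unit.app x))
    (counitComp : ∀ y : E, Companion (adj.counit.app y)) :
    ∃ A : LaxAdjunction F.toPseudofunctor G.toPseudofunctor,
      adj.unit.IsTranspose unitComp (fun x => A.unit.app ⟨x⟩)
        (fun {x y} m => A.unit.naturality (a := ⟨x⟩) (b := ⟨y⟩) m) ∧
      adj.counit.IsTranspose counitComp (fun y => A.counit.app ⟨y⟩)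
        (fun {x y} n => A.counit.naturality (a := ⟨x⟩) (b := ⟨y⟩) n) ∧
      (adj.unit.HasCommuterCells unitComp → adj.counit.HasCommuterCells counitComp →
        A.IsBiadjunction) := by
  refine ⟨adj.laxAdjunction unitComp counitComp, adj.unit.isTranspose_slideApp unitComp,
    adj.counit.isTranspose_slideApp counitComp, ?_⟩
  intro unit_commuters counit_commuters
  exact ⟨fun m => unit_commuters m, fun n => counit_commuters n⟩
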